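/- Let $K\ge 1$ be a number of arms. In round $t=1,2,\dots$ an adversary fixes a preference matrix $P_t\in[0,1]^{K\times K}$ with $P_t(a,b)+P_t(b,a)=1$ for all $a,b$ (in particular $P_t(a,a)=\tfrac12$); $P_t$ may depend on everything that happened in rounds $1,\dots,t-1$. Two players $i\in\{+1,-1\}$ independently sample arms $k_{i,t}\sim p_{i,t}$, and the feedback $o_t(k_{+1,t},k_{-1,t})$ is observed. It is Bernoulli with parameter $P_t(k_{+1,t},k_{-1,t})$ if the two arms differ, and equals $\tfrac12$ if they coincide. Set $o_t(k_{-1,t},k_{+1,t})=1-o_t(k_{+1,t},k_{-1,t})$. The algorithm starts from $\hat L_{i,0}=0$ and uses the regularizers $$\Psi_t(w)=-2\sqrt t\,\sum_{k=1}^K\bigl(\sqrt{w_k}-w_k/2\bigr)$$ (the $\tfrac12$-Tsallis regularizer with learning rate $2/\sqrt t$). Writing $\mathcal I_{\Delta}$ for the indicator (values $0$ and $+\infty$) of the probability simplex and $^*$ for convex conjugation, it sets $$p_{i,t}=\nabla(\Psi_t+\mathcal I_{\Delta})^*(-\hat L_{i,t-1}),\qquad \hat\ell_{i,t}(k)=\frac{o_t(k_{-i,t},k_{i,t})}{p_{i,t}(k)}\,\mathbf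 1\{k=k_{i,t}\},\qquad \hat L_{i,t}=\hat L_{i,t-1}+\hat\ell_{i,t}.$$ Let $R_T(k)=\sum_{t=1}^T\frac12\bigl(P_t(k,k_{+1,t})+P_t(k,k_{-1,t})-1\bigr)$ and let $\overline R_T=\max_{k}\mathbf E[R_T(k)]$ be the pseudo-regret. Then for every $T\ge 1$, $$\overline R_T\le 4\sqrt{KT}+1 .$$ Suppose moreover that $K\ge2$ and that there are a vector $(\Delta_k)_{k}\in[0,1]^K$ whose unique zero coordinate is $k^*$, and a number $C\ge0$, such that $$\overline R_T\ \ge\ \frac12\,\mathbf E\Bigl[\sum_{t=1}^T\sum_{k\ne k^*}\bigl(p_{+1,t}(k)+p_{-1,t}(k)\bigr)\Delta_k\Bigr]-C .$$ Then, with $\Delta_{\min}=\min_{k\ne k^*}\Delta_k$, $$\overline R_T\le\sum_{k\ne k^*}\frac{4\log T+12}{\Delta_k}+4\log T+\frac1{\Delta_{\min}}+\frac32\sqrt K+8+C .$$ -/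

import Mathlib

noncomputable section

namespace Dueling

/-- What happens in one round: the arms `r.1 true` (player `+1`) and `r.1 false` (player `-1`),
and the coded feedback `r.2`, see `feedback`. -/
abbrev Round (K : ℕ) : Type := (Bool → Fin K) × Fin 3

/-- The history of the first `t` rounds. -/
abbrev History (K t : ℕ) : Type := Fin t → Round K

/-- The part of a trajectory that precedes round `t` (rounds are numbered from `0`). -/
def History.before {K T : ℕ} (ω : History K T) (t : Fin T) : History K t :=
  fun s => ω (Fin.castLE t.isLt.le s)

/-- The observed preference feedback `o(k₊, k₋)`: one of `0`, `1/2`, `1`, coded by `0`, `1`, `2`. -/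
def feedback {K : ℕ} (r : Round K) : ℝ := ((r.2 : ℕ) : ℝ) / 2

/-- The loss `o(k₋ᵢ, kᵢ)` of player `i` for the arm it has played, where
`o(k₋, k₊) = 1 - o(k₊, k₋)`. -/
def observedLoss {K : ℕ} (i : Bool) (r : Round K) : ℝ :=
  if i then 1 - feedback r else feedback r

/-- Preference matrices: `M a b` is the probability that `a` is preferred over `b`. -/
def IsPreferenceMatrix {K : ℕ} (M : Matrix (Fin K) (Fin K) ℝ) : Prop :=
  ∀ a b, M a b ∈ Set.Icc (0 : ℝ) 1 ∧ M a b + M b a = 1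

/-- The environment: the preference matrix of the next round, given the history so far.
An environment that ignores the history is a fixed sequence of matrices. -/
abbrev Environment (K : ℕ) : Type := (t : ℕ) → History K t → Matrix (Fin K) (Fin K) ℝ

/-- The probability of the coded feedback `o` in a duel of `a` against `b`: Bernoulli with
parameter `M a b` for distinct arms, and the constant `1/2` when an arm is compared to itself. -/
def feedbackProb {K : ℕ} (M : Matrix (Fin K) (Fin K) ℝ) (a b : Fin K) (o : Fin 3) : ℝ :=
  if a = b then (if o = 1 then 1 else 0)
  else if o = 2 then M a b else if o = 0 then 1 - M a b else 0

/-- The `1/2`-Tsallis regularizer in round `t ≥ 1`, with learning rate `2 / √t`. -/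
def regularizer {K : ℕ} (t : ℕ) (w : Fin K → ℝ) : ℝ :=
  -(2 * √(t : ℝ) * ∑ k, (√(w k) - w k / 2))

/-- The convex conjugate of the regularizer plus the indicator of the probability simplex. -/
def conjugate {K : ℕ} (t : ℕ) (x : EuclideanSpace ℝ (Fin K)) : ℝ :=
  ⨆ w : stdSimplex ℝ (Fin K), (∑ k, w.1 k * x k - regularizer t w.1)

/-- The sampling distribution in round `t ≥ 1` when the cumulative estimated losses are `L`. -/
def mirrorStep {K : ℕ} (t : ℕ) (L : EuclideanSpace ℝ (Fin K)) : EuclideanSpace ℝ (Fin K) :=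
  gradient (conjugate t) (-L)

/-- The importance-weighted loss estimate of player `i`, who sampled its arm from `p`. -/
def lossEstimate {K : ℕ} (i : Bool) (p : EuclideanSpace ℝ (Fin K)) (r : Round K) :
    EuclideanSpace ℝ (Fin K) :=
  WithLp.toLp 2 fun k => if k = r.1 i then observedLoss i r / p k else 0

/-- The cumulative estimated losses of player `i` after `t` rounds. -/
def cumulativeEstimate {K : ℕ} (i : Bool) :
    (t : ℕ) → History K t → EuclideanSpace ℝ (Fin K)
  | 0, _ => 0
  | t + 1, h =>
    cumulativeEstimate i t (fun s => h s.castSucc) +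
      lossEstimate i (mirrorStep (t + 1) (cumulativeEstimate i t fun s => h s.castSucc))
        (h (Fin.last t))

/-- The distribution from which player `i` samples its next arm after the history `h`. -/
def samplingDist {K : ℕ} (i : Bool) {t : ℕ} (h : History K t) : EuclideanSpace ℝ (Fin K) :=
  mirrorStep (t + 1) (cumulativeEstimate i t h)

/-- The conditional probability of the next round `r` after the history `h`: the two arms are
sampled independently, and then the feedback is drawn. -/
def roundProb {K : ℕ} (P : Environment K) {t : ℕ} (h : History K t) (r : Round K) : ℝ :=
  samplingDist true h (r.1 true) * samplingDist false h (r.1 false) *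
    feedbackProb (P t h) (r.1 true) (r.1 false) r.2

/-- The probability of a trajectory of `T` rounds. -/
def trajectoryProb {K T : ℕ} (P : Environment K) (ω : History K T) : ℝ :=
  ∏ t : Fin T, roundProb P (ω.before t) (ω t)

/-- Expectation over the (finitely many) trajectories of `T` rounds. -/
def expectation {K T : ℕ} (P : Environment K) (f : History K T → ℝ) : ℝ :=
  ∑ ω : History K T, trajectoryProb P ω * f ω

/-- The regret against the fixed arm `k`, along a trajectory. -/
def regret {K T : ℕ} (P : Environment K) (k : Fin K) (ω : History K T) : ℝ :=
  ∑ t : Fin T, 1 / 2 *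
    (P t (ω.before t) k ((ω t).1 true) + P t (ω.before t) k ((ω t).1 false) - 1)

/-- The pseudo-regret: the largest expected regret against a fixed arm. -/
def pseudoRegret {K : ℕ} (P : Environment K) (T : ℕ) : ℝ :=
  ⨆ k : Fin K, expectation P (regret (T := T) P k)

/-- The self-bounding condition with gap vector `Δ`, reference arm `kstar` and slack `C`. -/
def SelfBounding {K : ℕ} (P : Environment K) (T : ℕ) (Δ : Fin K → ℝ) (kstar : Fin K)
    (C : ℝ) : Prop :=
  pseudoRegret P T ≥
    1 / 2 * expectation P (fun ω : History K T =>
      ∑ t : Fin T, ∑ k ∈ Finset.univ.erase kstar,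
        (samplingDist true (ω.before t) k + samplingDist false (ω.before t) k) * Δ k) - C

end Dueling

end

/-!
The two players run follow-the-regularized-leader (Tsallis-INF) against each other. Their observed
losses add up to `1` and their loss estimates are unbiased, so the expected instantaneous regret of
the duel is half the sum of the expected estimated regrets of the players
(`sum_roundProb_mul_regret`), and it suffices to bound each player as in an ordinary bandit problem.

The mirror step is explicit. Weak duality (`conjugate_le`) with the multiplier `lam` that solves
`∑ k, t / (L k + lam) ^ 2 = 1` shows that `t / (L k + lam) ^ 2` is the maximizer, and the same
bound, used near `-L`, shows that the conjugate is differentiable there with this gradient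
(`hasGradientAt_conjugate`). Dropping the simplex constraint also bounds the Bregman divergence of
the conjugate coordinate by coordinate, after an arbitrary shift of the losses
(`conjugate_bregman_le`). Without a shift the conditional expectation of the stability term is at
most `∑ k, √(p k) / √t`; shifted by the observed loss, it is at most
`∑ k, √(p k) * (1 - p k) / √t + 1 / t`, where a dominating arm contributes little.

The change of the learning rate costs `2 * (√t - √(t - 1)) * (∑ k, √(p k) - 1)` in round `t`. A
supermartingale argument (`two_mul_expectation_regret_le`) adds these costs up to a bound for the
pseudo-regret that does not depend on the comparator. Together with `∑ k, √(p k) ≤ √K`, the first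
stability bound gives `4 * √(K * T)`.

Under self-bounding, the regret `R = 2 * R - R` is at most twice the regret bound minus the
self-bounding lower bound. Once the reference arm has been eliminated through
`1 - p kstar = ∑ k ≠ kstar, p k`, every other arm contributes about `4 * v / √t - v ^ 2 * Δ` with
`v = √(p k)`, which is at most `4 / (t * Δ)`; the sum over `t` is logarithmic. The corrections are
absorbed by `self_bounding_scalar`, whose error term telescopes in `sum_armCost_le_telescoping`.
-/

noncomputable section

namespace Dueling

open Finset

variable {K : ℕ}

/-! ### The conjugate and its gradient -/

theorem sub_regularizer_eq {w : Fin K → ℝ} (hw : w ∈ stdSimplex ℝ (Fin K)) (t : ℕ)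
    (x : Fin K → ℝ) :
    ∑ k, w k * x k - regularizer t w = ∑ k, (w k * x k + 2 * √(t : ℝ) * √(w k)) - √(t : ℝ) := by
  have h1 : ∑ k, w k / 2 = 1 / 2 := by rw [← Finset.sum_div, hw.2]
  simp only [regularizer, Finset.sum_sub_distrib, h1, Finset.sum_add_distrib, ← Finset.mul_sum]
  ring

theorem two_mul_sqrt_mul_sqrt_sub_le {t w a : ℝ} (ht : 0 ≤ t) (hw : 0 ≤ w) (ha : 0 < a) :
    2 * √t * √w - w * a ≤ t / a := by
  rw [le_div_iff₀ ha]
  have h1 := Real.sq_sqrt ht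
  have h2 := Real.sq_sqrt hw
  calc (2 * √t * √w - w * a) * a = √t ^ 2 - (√t - √w * a) ^ 2 := by
        nth_rewrite 2 [← h2]; ring
    _ ≤ t := by rw [h1]; linarith [sq_nonneg (√t - √w * a)]

/-- Weak duality: a Lagrange multiplier `lam` for the constraint `∑ k, w k = 1` bounds the
objective whose supremum is the conjugate. -/
theorem objective_le {w : Fin K → ℝ} (hw : w ∈ stdSimplex ℝ (Fin K)) (t : ℕ) (x : Fin K → ℝ)
    {lam : ℝ} (hlam : ∀ k, x k < lam) :
    ∑ k, w k * x k - regularizer t w ≤ lam + ∑ k, (t : ℝ) / (lam - x k) - √(t : ℝ) := by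
  rw [sub_regularizer_eq hw]
  have h1 : lam = ∑ k, w k * lam := by rw [← Finset.sum_mul, hw.2, one_mul]
  have h2 : ∑ k, (w k * x k + 2 * √(t : ℝ) * √(w k)) ≤
      ∑ k, (w k * lam + (t : ℝ) / (lam - x k)) := by
    refine Finset.sum_le_sum fun k _ => ?_
    have := two_mul_sqrt_mul_sqrt_sub_le (Nat.cast_nonneg t : (0 : ℝ) ≤ t) (hw.1 k) (sub_pos.2 (hlam k))
    linarith
  have h3 := Finset.sum_add_distrib (s := Finset.univ) (f := fun k => w k * lam)
    (g := fun k => (t : ℝ) / (lam - x k))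
  linarith

theorem exists_forall_lt (x : Fin K → ℝ) : ∃ lam, ∀ k, x k < lam := by
  obtain ⟨c, hc⟩ := (Set.finite_range x).bddAbove
  exact ⟨c + 1, fun k => lt_of_le_of_lt (hc ⟨k, rfl⟩) (lt_add_one c)⟩

theorem conjugate_le (hK : 1 ≤ K) (t : ℕ) (x : EuclideanSpace ℝ (Fin K)) {lam : ℝ}
    (hlam : ∀ k, x k < lam) :
    conjugate t x ≤ lam + ∑ k, (t : ℝ) / (lam - x k) - √(t : ℝ) := by
  have : NeZero K := ⟨by omega⟩
  have : Nonempty (stdSimplex ℝ (Fin K)) := ⟨⟨_, single_mem_stdSimplex ℝ (0 : Fin K)⟩⟩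
  exact ciSup_le fun w => objective_le w.2 t _ hlam

theorem le_conjugate (t : ℕ) (x : EuclideanSpace ℝ (Fin K)) {w : Fin K → ℝ}
    (hw : w ∈ stdSimplex ℝ (Fin K)) :
    ∑ k, (w k * x k + 2 * √(t : ℝ) * √(w k)) - √(t : ℝ) ≤ conjugate t x := by
  rw [← sub_regularizer_eq hw]
  obtain ⟨lam, hlam⟩ := exists_forall_lt (fun k => x k)
  have hb : BddAbove (Set.range fun w : stdSimplex ℝ (Fin K) =>
      (∑ k, w.1 k * x k - regularizer t w.1)) := by
    refine ⟨lam + ∑ k, (t : ℝ) / (lam - x k) - √(t : ℝ), ?_⟩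
    rintro _ ⟨w, rfl⟩
    exact objective_le w.2 t _ hlam
  exact le_ciSup hb ⟨w, hw⟩

/-- The Lagrange multiplier that normalizes the first-order condition `√t / √(w k) = L k + lam`. -/
theorem exists_multiplier (hK : 1 ≤ K) {t : ℕ} (ht : 0 < t) (L : Fin K → ℝ) :
    ∃ lam : ℝ, (∀ k, 0 < L k + lam) ∧ ∑ k, (t : ℝ) / (L k + lam) ^ 2 = 1 := by
  have : NeZero K := ⟨by omega⟩
  obtain ⟨k₀, hk₀⟩ := Finite.exists_min L
  have htr : (0 : ℝ) < t := by exact_mod_cast ht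
  have hKr : (1 : ℝ) ≤ K := by exact_mod_cast hK
  set f : ℝ → ℝ := fun lam => ∑ k, (t : ℝ) / (L k + lam) ^ 2 with hf
  have hs : 0 < √(t : ℝ) := Real.sqrt_pos.2 htr
  have hpos : ∀ lam, √(t : ℝ) - L k₀ ≤ lam → ∀ k, 0 < L k + lam := fun lam h k => by
    linarith [hk₀ k]
  have hle : √(t : ℝ) - L k₀ ≤ √(K * t : ℝ) - L k₀ := by
    gcongr; nlinarith
  have hc : ContinuousOn f (Set.Icc (√(t : ℝ) - L k₀) (√(K * t : ℝ) - L k₀)) := by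
    refine continuousOn_finsetSum _ fun k _ => ?_
    refine ContinuousOn.div continuousOn_const (by fun_prop) fun lam hl => ?_
    exact pow_ne_zero _ (hpos lam hl.1 k).ne'
  have h1 : (1 : ℝ) ≤ f (√(t : ℝ) - L k₀) := by
    have h2 : (t : ℝ) / (L k₀ + (√(t : ℝ) - L k₀)) ^ 2 = 1 := by
      rw [add_sub_cancel, Real.sq_sqrt htr.le, div_self htr.ne']
    rw [← h2]
    exact Finset.single_le_sum (f := fun k => (t : ℝ) / (L k + (√(t : ℝ) - L k₀)) ^ 2)
      (fun k _ => by positivity) (Finset.mem_univ k₀)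
  have h2 : f (√(K * t : ℝ) - L k₀) ≤ 1 := by
    have : ∀ k ∈ (Finset.univ : Finset (Fin K)),
        (t : ℝ) / (L k + (√(K * t : ℝ) - L k₀)) ^ 2 ≤ 1 / K := fun k _ => by
      have h3 : (K * t : ℝ) ≤ (L k + (√(K * t : ℝ) - L k₀)) ^ 2 := by
        calc (K * t : ℝ) = √(K * t : ℝ) ^ 2 := (Real.sq_sqrt (by positivity)).symm
          _ ≤ _ := by gcongr; linarith [hk₀ k]
      rw [div_le_div_iff₀ (lt_of_lt_of_le (by positivity) h3) (by positivity)]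
      linarith
    calc f (√(K * t : ℝ) - L k₀) ≤ ∑ _k : Fin K, 1 / (K : ℝ) := Finset.sum_le_sum this
      _ = 1 := by simp
  obtain ⟨lam, hl, he⟩ := intermediate_value_Icc' hle hc ⟨h2, h1⟩
  exact ⟨lam, hpos lam hl.1, he⟩

/-- The maximizer at `-L` defines an affine minorant of the conjugate, with slope
`t / (L k + lam) ^ 2`. -/
theorem sum_div_sq_mul_le_conjugate {t : ℕ} {L : EuclideanSpace ℝ (Fin K)} {lam : ℝ}
    (hpos : ∀ k, 0 < L k + lam) (hsum : ∑ k, (t : ℝ) / (L k + lam) ^ 2 = 1)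
    (x : EuclideanSpace ℝ (Fin K)) :
    lam + ∑ k, (t : ℝ) / (L k + lam) - √(t : ℝ) + ∑ k, (t : ℝ) / (L k + lam) ^ 2 * (x k + L k)
      ≤ conjugate t x := by
  have h := le_conjugate t x (w := fun k => (t : ℝ) / (L k + lam) ^ 2)
    ⟨fun k => by positivity, hsum⟩
  refine le_trans (le_of_eq ?_) h
  have h1 : lam = ∑ k, (t : ℝ) / (L k + lam) ^ 2 * lam := by rw [← Finset.sum_mul, hsum, one_mul]
  have h2 : lam + ∑ k, (t : ℝ) / (L k + lam) + ∑ k, (t : ℝ) / (L k + lam) ^ 2 * (x k + L k) =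
      ∑ k, ((t : ℝ) / (L k + lam) ^ 2 * x k +
        2 * √(t : ℝ) * √((t : ℝ) / (L k + lam) ^ 2)) := by
    nth_rewrite 1 [h1]
    rw [← Finset.sum_add_distrib, ← Finset.sum_add_distrib]
    refine Finset.sum_congr rfl fun k _ => ?_
    have hp := hpos k
    rw [Real.sqrt_div (Nat.cast_nonneg t), Real.sqrt_sq hp.le]
    have h3 : 2 * √(t : ℝ) * (√(t : ℝ) / (L k + lam)) = 2 * (t : ℝ) / (L k + lam) := by
      rw [← mul_div_assoc, mul_assoc, Real.mul_self_sqrt (Nat.cast_nonneg t)]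
    rw [h3]
    field_simp
    ring
  linarith

theorem conjugate_neg_eq (hK : 1 ≤ K) {t : ℕ} {L : EuclideanSpace ℝ (Fin K)} {lam : ℝ}
    (hpos : ∀ k, 0 < L k + lam) (hsum : ∑ k, (t : ℝ) / (L k + lam) ^ 2 = 1) :
    conjugate t (-L) = lam + ∑ k, (t : ℝ) / (L k + lam) - √(t : ℝ) := by
  apply le_antisymm
  · have := conjugate_le hK t (-L) (lam := lam) fun k => by
      have := hpos k; simp only [PiLp.neg_apply]; linarith
    simpa [add_comm lam] using this
  · have := sum_div_sq_mul_le_conjugate hpos hsum (-L)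
    simpa using this

/-- Danskin's theorem for the conjugate: `conjugate_le` and `le_conjugate`, both with the data of
the maximizer at `-L`, squeeze the conjugate between its linearization and the linearization plus
a quadratic error. -/
theorem hasGradientAt_conjugate (hK : 1 ≤ K) {t : ℕ} {L : EuclideanSpace ℝ (Fin K)} {lam : ℝ}
    (hpos : ∀ k, 0 < L k + lam) (hsum : ∑ k, (t : ℝ) / (L k + lam) ^ 2 = 1) :
    HasGradientAt (conjugate t)
      (WithLp.toLp 2 fun k => (t : ℝ) / (L k + lam) ^ 2 : EuclideanSpace ℝ (Fin K)) (-L) := by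
  rw [hasGradientAt_iff_isLittleO]
  set p : EuclideanSpace ℝ (Fin K) := WithLp.toLp 2 fun k => (t : ℝ) / (L k + lam) ^ 2 with hp
  have hinner : ∀ x : EuclideanSpace ℝ (Fin K), inner ℝ p (x - -L) =
      ∑ k, (t : ℝ) / (L k + lam) ^ 2 * (x k + L k) := fun x => by
    simp [PiLp.inner_apply, hp, mul_comm]
  set C : ℝ := ∑ k, (t : ℝ) * 2 / (L k + lam) ^ 3 with hC
  have hev : ∀ᶠ x : EuclideanSpace ℝ (Fin K) in nhds (-L),
      ∀ k, (L k + lam) / 2 < lam - x k := by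
    rw [Filter.eventually_all]
    intro k
    have hcont : Continuous fun x : EuclideanSpace ℝ (Fin K) => lam - x k := by fun_prop
    refine hcont.continuousAt.eventually (lt_mem_nhds ?_)
    have := hpos k
    simp only [PiLp.neg_apply]
    linarith
  have hO : (fun x => conjugate t x - conjugate t (-L) - inner ℝ p (x - -L)) =O[nhds (-L)]
      fun x => ‖x - -L‖ ^ 2 := by
    refine Asymptotics.IsBigO.of_bound C ?_
    filter_upwards [hev] with x hx
    have hlow := sum_div_sq_mul_le_conjugate hpos hsum x
    have hup := conjugate_le hK t x (lam := lam) fun k => by linarith [hx k, hpos k]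
    rw [hinner, conjugate_neg_eq hK hpos hsum, Real.norm_eq_abs, abs_of_nonneg (by linarith),
      Real.norm_eq_abs, abs_of_nonneg (by positivity), hC, Finset.sum_mul]
    have hterm : ∑ k, (t : ℝ) / (lam - x k) ≤ ∑ k, ((t : ℝ) / (L k + lam) +
        (t : ℝ) / (L k + lam) ^ 2 * (x k + L k) + (t : ℝ) * 2 / (L k + lam) ^ 3 *
          ‖x - -L‖ ^ 2) := by
      refine Finset.sum_le_sum fun k _ => ?_
      have ha := hpos k
      have hb := hx k
      have hnorm : (x k + L k) ^ 2 ≤ ‖x - -L‖ ^ 2 := by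
        have := PiLp.norm_apply_le (x - -L) k
        simp only [sub_neg_eq_add, PiLp.add_apply, Real.norm_eq_abs] at this ⊢
        rw [← sq_abs]
        gcongr
      have hb' : 0 < lam - x k := by linarith
      have key : (t : ℝ) / (lam - x k) = (t : ℝ) / (L k + lam) +
        (t : ℝ) / (L k + lam) ^ 2 * (x k + L k) +
          (t : ℝ) / (L k + lam) ^ 2 * (1 / (lam - x k)) * (x k + L k) ^ 2 := by
        field_simp
        ring
      rw [key]
      gcongr
      have : 1 / (lam - x k) ≤ 2 / (L k + lam) := by
        rw [div_le_div_iff₀ hb' ha]; linarith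
      calc (t : ℝ) / (L k + lam) ^ 2 * (1 / (lam - x k))
          ≤ (t : ℝ) / (L k + lam) ^ 2 * (2 / (L k + lam)) := by gcongr
        _ = (t : ℝ) * 2 / (L k + lam) ^ 3 := by field_simp
    rw [Finset.sum_add_distrib, Finset.sum_add_distrib] at hterm
    linarith
  refine hO.trans_isLittleO ?_
  have h0 : (fun x : EuclideanSpace ℝ (Fin K) => ‖x - -L‖) =o[nhds (-L)] fun _ => (1 : ℝ) := by
    rw [Asymptotics.isLittleO_one_iff]
    have : Continuous fun x : EuclideanSpace ℝ (Fin K) => ‖x - -L‖ := by fun_prop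
    simpa using this.tendsto (-L)
  have := (Asymptotics.isBigO_refl (fun x : EuclideanSpace ℝ (Fin K) => ‖x - -L‖)
    (nhds (-L))).mul_isLittleO h0
  simp only [mul_one, ← sq] at this
  exact this.of_norm_right

theorem mirrorStep_eq (hK : 1 ≤ K) {t : ℕ} {L : EuclideanSpace ℝ (Fin K)} {lam : ℝ}
    (hpos : ∀ k, 0 < L k + lam) (hsum : ∑ k, (t : ℝ) / (L k + lam) ^ 2 = 1) (k : Fin K) :
    mirrorStep t L k = (t : ℝ) / (L k + lam) ^ 2 := by
  rw [mirrorStep, (hasGradientAt_conjugate hK hpos hsum).gradient]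

theorem mirrorStep_pos (hK : 1 ≤ K) {t : ℕ} (ht : 0 < t) (L : EuclideanSpace ℝ (Fin K))
    (k : Fin K) : 0 < mirrorStep t L k := by
  obtain ⟨lam, hpos, hsum⟩ := exists_multiplier hK ht fun k => L k
  rw [mirrorStep_eq hK hpos hsum]
  have := hpos k
  positivity

theorem sum_mirrorStep (hK : 1 ≤ K) {t : ℕ} (ht : 0 < t) (L : EuclideanSpace ℝ (Fin K)) :
    ∑ k, mirrorStep t L k = 1 := by
  obtain ⟨lam, hpos, hsum⟩ := exists_multiplier hK ht fun k => L k
  simpa only [mirrorStep_eq hK hpos hsum] using hsum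

theorem mirrorStep_mem (hK : 1 ≤ K) {t : ℕ} (ht : 0 < t) (L : EuclideanSpace ℝ (Fin K)) :
    (fun k => mirrorStep t L k) ∈ stdSimplex ℝ (Fin K) :=
  ⟨fun k => (mirrorStep_pos hK ht L k).le, sum_mirrorStep hK ht L⟩

/-- The mirror step attains the supremum that defines the conjugate. -/
theorem conjugate_eq_mirrorStep (hK : 1 ≤ K) {t : ℕ} (ht : 0 < t)
    (L : EuclideanSpace ℝ (Fin K)) :
    conjugate t (-L) =
      ∑ k, (mirrorStep t L k * (-L) k + 2 * √(t : ℝ) * √(mirrorStep t L k)) - √(t : ℝ) := by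
  refine le_antisymm ?_ (le_conjugate t (-L) (mirrorStep_mem hK ht L))
  obtain ⟨lam, hpos, hsum⟩ := exists_multiplier hK ht fun k => L k
  rw [conjugate_neg_eq hK hpos hsum]
  have h1 : lam = ∑ k, mirrorStep t L k * lam := by
    rw [← Finset.sum_mul, sum_mirrorStep hK ht, one_mul]
  have h2 : lam + ∑ k, (t : ℝ) / (L k + lam) =
      ∑ k, (mirrorStep t L k * (-L) k + 2 * √(t : ℝ) * √(mirrorStep t L k)) := by
    nth_rewrite 1 [h1]
    rw [← Finset.sum_add_distrib]
    refine Finset.sum_congr rfl fun k _ => ?_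
    have hp := hpos k
    rw [mirrorStep_eq hK hpos hsum, Real.sqrt_div (Nat.cast_nonneg t), Real.sqrt_sq hp.le]
    have h3 : 2 * √(t : ℝ) * (√(t : ℝ) / (L k + lam)) = 2 * (t : ℝ) / (L k + lam) := by
      rw [← mul_div_assoc, mul_assoc, Real.mul_self_sqrt (Nat.cast_nonneg t)]
    rw [h3, PiLp.neg_apply]
    field_simp
    ring
  linarith

/-- The Bregman divergence of the conjugate between `-L` and `-(L + y)`. Since the conjugate
changes by a constant along the all-ones vector, `y` may be shifted by any `x`; dropping the
simplex constraint then splits the divergence into one explicit term per coordinate. -/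
theorem conjugate_bregman_le (hK : 1 ≤ K) {t : ℕ} (ht : 0 < t) (L y : EuclideanSpace ℝ (Fin K))
    (x : ℝ) (hx : ∀ k, 0 < √(t : ℝ) + (y k - x) * √(mirrorStep t L k)) :
    conjugate t (-(L + y)) - conjugate t (-L) + ∑ k, mirrorStep t L k * y k ≤
      ∑ k, (y k - x) ^ 2 * √(mirrorStep t L k) ^ 3 /
        (√(t : ℝ) + (y k - x) * √(mirrorStep t L k)) := by
  obtain ⟨lam, hpos, hsum⟩ := exists_multiplier hK ht fun k => L k
  have htr : (0 : ℝ) < t := by exact_mod_cast ht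
  have hs : 0 < √(t : ℝ) := Real.sqrt_pos.2 htr
  have hv : ∀ k, √(mirrorStep t L k) = √(t : ℝ) / (L k + lam) := fun k => by
    rw [mirrorStep_eq hK hpos hsum, Real.sqrt_div (Nat.cast_nonneg t), Real.sqrt_sq (hpos k).le]
  have hden : ∀ k, 0 < L k + lam + (y k - x) := fun k => by
    have h := hx k
    have hp := hpos k
    rw [hv] at h
    have h2 : √(t : ℝ) + (y k - x) * (√(t : ℝ) / (L k + lam)) =
        √(t : ℝ) / (L k + lam) * (L k + lam + (y k - x)) := by field_simp
    rw [h2] at h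
    exact pos_of_mul_pos_right h (by positivity)
  have hup := conjugate_le hK t (-(L + y)) (lam := lam - x) fun k => by
    have := hden k; simp only [PiLp.neg_apply, PiLp.add_apply]; linarith
  rw [conjugate_neg_eq hK hpos hsum]
  have hxs : x = ∑ k, mirrorStep t L k * x := by
    rw [← Finset.sum_mul, sum_mirrorStep hK ht, one_mul]
  have hterm : ∑ k, (t : ℝ) / (lam - x - (-(L + y)) k) - ∑ k, (t : ℝ) / (L k + lam)
      + ∑ k, mirrorStep t L k * y k - ∑ k, mirrorStep t L k * x =
      ∑ k, (y k - x) ^ 2 * √(mirrorStep t L k) ^ 3 /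
        (√(t : ℝ) + (y k - x) * √(mirrorStep t L k)) := by
    rw [← Finset.sum_sub_distrib, ← Finset.sum_add_distrib, ← Finset.sum_sub_distrib]
    refine Finset.sum_congr rfl fun k _ => ?_
    have hp := hpos k
    have hd := hden k
    rw [hv, mirrorStep_eq hK hpos hsum]
    have h1 : lam - x - (-(L + y)) k = L k + lam + (y k - x) := by
      simp only [PiLp.neg_apply, PiLp.add_apply]; ring
    have h2 : √(t : ℝ) + (y k - x) * (√(t : ℝ) / (L k + lam)) =
        √(t : ℝ) / (L k + lam) * (L k + lam + (y k - x)) := by field_simp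
    rw [h1, h2]
    have h3 : √(t : ℝ) ^ 2 = t := Real.sq_sqrt htr.le
    have h4 : (y k - x) ^ 2 * (√(t : ℝ) / (L k + lam)) ^ 3 /
        (√(t : ℝ) / (L k + lam) * (L k + lam + (y k - x))) =
        (y k - x) ^ 2 * (t : ℝ) / ((L k + lam) ^ 2 * (L k + lam + (y k - x))) := by
      nth_rewrite 3 [← h3]
      field_simp
    rw [h4]
    field_simp
    ring
  linarith

/-! ### Stability -/

theorem observedLoss_mem (i : Bool) (r : Round K) : observedLoss i r ∈ Set.Icc (0 : ℝ) 1 := by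
  obtain ⟨_, o⟩ := r
  fin_cases o <;> cases i <;> norm_num [observedLoss, feedback]

theorem observedLoss_true_add_false (r : Round K) :
    observedLoss true r + observedLoss false r = 1 := by
  simp [observedLoss]

theorem sum_mul_lossEstimate {p : EuclideanSpace ℝ (Fin K)} (hp : ∀ k, 0 < p k) (i : Bool)
    (r : Round K) : ∑ k, p k * lossEstimate i p r k = observedLoss i r := by
  simp only [lossEstimate, mul_ite, mul_zero, Finset.sum_ite_eq', Finset.mem_univ, if_true]
  exact mul_div_cancel₀ _ (hp _).ne'

/-- The stability term of follow-the-regularized-leader in round `t`: the excess of the incurred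
loss over the decrease of the conjugate. -/
def stability (t : ℕ) (L : EuclideanSpace ℝ (Fin K)) (i : Bool) (r : Round K) : ℝ :=
  observedLoss i r + conjugate t (-(L + lossEstimate i (mirrorStep t L) r)) - conjugate t (-L)

theorem stability_le_sum (hK : 1 ≤ K) {t : ℕ} (ht : 0 < t) (L : EuclideanSpace ℝ (Fin K))
    (i : Bool) (r : Round K) (x : ℝ)
    (hx : ∀ k, 0 < √(t : ℝ) +
      (lossEstimate i (mirrorStep t L) r k - x) * √(mirrorStep t L k)) :
    stability t L i r ≤
      ∑ k, (lossEstimate i (mirrorStep t L) r k - x) ^ 2 * √(mirrorStep t L k) ^ 3 /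
        (√(t : ℝ) + (lossEstimate i (mirrorStep t L) r k - x) * √(mirrorStep t L k)) := by
  have h := conjugate_bregman_le hK ht L _ x hx
  rw [sum_mul_lossEstimate (mirrorStep_pos hK ht L)] at h
  unfold stability
  linarith

theorem lossEstimate_nonneg {p : EuclideanSpace ℝ (Fin K)} (hp : ∀ k, 0 < p k) (i : Bool)
    (r : Round K) (k : Fin K) : 0 ≤ lossEstimate i p r k := by
  simp only [lossEstimate]
  split_ifs
  · exact div_nonneg (observedLoss_mem i r).1 (hp k).le
  · exact le_rfl

theorem stability_le_one (hK : 1 ≤ K) {t : ℕ} (ht : 0 < t) (L : EuclideanSpace ℝ (Fin K))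
    (i : Bool) (r : Round K) : stability t L i r ≤ 1 := by
  obtain ⟨lam, hpos, hsum⟩ := exists_multiplier hK ht fun k => L k
  have hy := lossEstimate_nonneg (mirrorStep_pos hK ht L) i r
  have hup := conjugate_le hK t (-(L + lossEstimate i (mirrorStep t L) r)) (lam := lam)
    fun k => by
      have h1 := hpos k
      have h2 := hy k
      simp only [PiLp.neg_apply, PiLp.add_apply]; linarith
  have hle : ∑ k, (t : ℝ) / (lam - (-(L + lossEstimate i (mirrorStep t L) r)) k) ≤
      ∑ k, (t : ℝ) / (L k + lam) := by
    refine Finset.sum_le_sum fun k _ => ?_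
    have h1 := hpos k
    have h2 := hy k
    refine div_le_div_of_nonneg_left (Nat.cast_nonneg t) h1 ?_
    simp only [PiLp.neg_apply, PiLp.add_apply]; linarith
  have h := (observedLoss_mem i r).2
  unfold stability
  rw [conjugate_neg_eq hK hpos hsum]
  linarith

theorem stability_le_inv_sqrt (hK : 1 ≤ K) {t : ℕ} (ht : 0 < t) (L : EuclideanSpace ℝ (Fin K))
    (i : Bool) (r : Round K) :
    stability t L i r ≤ 1 / (√(t : ℝ) * √(mirrorStep t L (r.1 i))) := by
  have hs : 0 < √(t : ℝ) := Real.sqrt_pos.2 (by exact_mod_cast ht)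
  have hp := mirrorStep_pos hK ht L
  have hy := lossEstimate_nonneg hp i r
  refine (stability_le_sum hK ht L i r 0 fun k => ?_).trans ?_
  · have := hy k
    rw [sub_zero]
    positivity
  rw [Finset.sum_eq_single (r.1 i)]
  · have hpj := hp (r.1 i)
    have hv : 0 < √(mirrorStep t L (r.1 i)) := Real.sqrt_pos.2 hpj
    have hsq : √(mirrorStep t L (r.1 i)) ^ 2 = mirrorStep t L (r.1 i) := Real.sq_sqrt hpj.le
    have hval : lossEstimate i (mirrorStep t L) r (r.1 i) =
        observedLoss i r / √(mirrorStep t L (r.1 i)) ^ 2 := by simp [lossEstimate, hsq]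
    have ho := observedLoss_mem i r
    have h1 := hy (r.1 i)
    rw [sub_zero]
    calc _ ≤ lossEstimate i (mirrorStep t L) r (r.1 i) ^ 2 *
          √(mirrorStep t L (r.1 i)) ^ 3 / √(t : ℝ) := by
          refine div_le_div_of_nonneg_left (by positivity) hs ?_
          have := mul_nonneg h1 hv.le
          linarith
      _ = observedLoss i r ^ 2 / (√(t : ℝ) * √(mirrorStep t L (r.1 i))) := by
          rw [hval]; field_simp
      _ ≤ _ := by
          gcongr
          exact pow_le_one₀ ho.1 ho.2
  · intro k _ hk
    simp [lossEstimate, hk]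
  · simp

/-- Stability of the shifted loss estimate. Shifting by the observed loss removes the dominating
contribution of an arm that is played almost always; the arms that are not played see a negative
loss, which is harmless once `√t` exceeds `1` by a margin. -/
theorem stability_le_shifted (hK : 1 ≤ K) {t : ℕ} (ht : 2 ≤ t) (L : EuclideanSpace ℝ (Fin K))
    (i : Bool) (r : Round K) :
    stability t L i r ≤ ∑ k, (if k = r.1 i then
      (1 - mirrorStep t L k) ^ 2 / (√(t : ℝ) * √(mirrorStep t L k)) else
      √(mirrorStep t L k) ^ 3 / √(t : ℝ) + 4 * √(mirrorStep t L k) ^ 4 / t) := by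
  have ht0 : 0 < t := by omega
  have hs : 0 < √(t : ℝ) := Real.sqrt_pos.2 (by exact_mod_cast ht0)
  have hs2 : √(t : ℝ) ^ 2 = t := Real.sq_sqrt (Nat.cast_nonneg t)
  have ht2 : (2 : ℝ) ≤ t := by exact_mod_cast ht
  have hs4 : 4 / 3 ≤ √(t : ℝ) := Real.le_sqrt_of_sq_le (by norm_num; linarith)
  have hp := mirrorStep_pos hK ht0 L
  have hp1 : ∀ k, mirrorStep t L k ≤ 1 := fun k => by
    rw [← sum_mirrorStep hK ht0 L]
    exact Finset.single_le_sum (f := fun k => mirrorStep t L k) (fun k _ => (hp k).le)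
      (Finset.mem_univ k)
  have ho := observedLoss_mem i r
  have hv : ∀ k, 0 < √(mirrorStep t L k) := fun k => Real.sqrt_pos.2 (hp k)
  have hv1 : ∀ k, √(mirrorStep t L k) ≤ 1 := fun k => Real.sqrt_le_one.2 (hp1 k)
  have hplayed : lossEstimate i (mirrorStep t L) r (r.1 i) - observedLoss i r =
      observedLoss i r * (1 - mirrorStep t L (r.1 i)) / √(mirrorStep t L (r.1 i)) ^ 2 := by
    have := (hp (r.1 i)).ne'
    simp only [lossEstimate, if_true, Real.sq_sqrt (hp (r.1 i)).le]
    field_simp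
  have hplayed0 : 0 ≤ lossEstimate i (mirrorStep t L) r (r.1 i) - observedLoss i r := by
    rw [hplayed]
    have := sub_nonneg.2 (hp1 (r.1 i))
    have := ho.1
    positivity
  refine (stability_le_sum hK ht0 L i r (observedLoss i r) fun k => ?_).trans
    (Finset.sum_le_sum fun k _ => ?_)
  · by_cases hk : k = r.1 i
    · subst hk
      positivity
    · simp only [lossEstimate, hk, if_false, zero_sub]
      nlinarith [mul_le_mul ho.2 (hv1 k) (hv k).le zero_le_one]
  · split_ifs with hk
    · subst hk
      have h1 := hv (r.1 i)
      calc _ ≤ (lossEstimate i (mirrorStep t L) r (r.1 i) - observedLoss i r) ^ 2 *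
            √(mirrorStep t L (r.1 i)) ^ 3 / √(t : ℝ) := by
            refine div_le_div_of_nonneg_left (by positivity) hs ?_
            have := mul_nonneg hplayed0 h1.le
            linarith
        _ = observedLoss i r ^ 2 * ((1 - mirrorStep t L (r.1 i)) ^ 2 /
              (√(t : ℝ) * √(mirrorStep t L (r.1 i)))) := by
            rw [hplayed]; field_simp
        _ ≤ _ := mul_le_of_le_one_left (by positivity) (pow_le_one₀ ho.1 ho.2)
    · simp only [lossEstimate, hk, if_false, zero_sub, neg_sq]
      have h1 := hv k
      have h2 := hv1 k
      have h3 : observedLoss i r * √(mirrorStep t L k) ≤ √(mirrorStep t L k) :=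
        mul_le_of_le_one_left h1.le ho.2
      calc _ ≤ 1 * √(mirrorStep t L k) ^ 3 / (√(t : ℝ) - √(mirrorStep t L k)) := by
            refine div_le_div₀ (by positivity) ?_ (by linarith) (by linarith)
            gcongr
            exact pow_le_one₀ ho.1 ho.2
        _ ≤ _ := by
            generalize √(mirrorStep t L k) = v at *
            generalize √(t : ℝ) = s at *
            rw [← hs2]
            have h4 : v ^ 3 / s + 4 * v ^ 4 / s ^ 2 = v ^ 3 * (s + 4 * v) / s ^ 2 := by
              field_simp
            rw [h4, div_le_div_iff₀ (by linarith) (by positivity)]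
            have h5 : s ^ 2 ≤ (s + 4 * v) * (s - v) := by nlinarith
            nlinarith [pow_pos h1 3]

theorem sum_mul_stability_bound_eq (hK : 1 ≤ K) {t : ℕ} (ht : 0 < t)
    (L : EuclideanSpace ℝ (Fin K)) :
    ∑ j, mirrorStep t L j * (1 / (√(t : ℝ) * √(mirrorStep t L j))) =
      (∑ k, √(mirrorStep t L k)) / √(t : ℝ) := by
  rw [Finset.sum_div]
  refine Finset.sum_congr rfl fun k _ => ?_
  have hp := mirrorStep_pos hK ht L k
  have hv : 0 < √(mirrorStep t L k) := Real.sqrt_pos.2 hp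
  have hs : 0 < √(t : ℝ) := Real.sqrt_pos.2 (by exact_mod_cast ht)
  have hsq := Real.sq_sqrt hp.le
  nth_rewrite 1 [← hsq]
  field_simp

theorem sum_mul_shifted_bound_le (hK : 1 ≤ K) {t : ℕ} (ht : 0 < t)
    (L : EuclideanSpace ℝ (Fin K)) :
    ∑ j, mirrorStep t L j * (∑ k, (if k = j then
      (1 - mirrorStep t L k) ^ 2 / (√(t : ℝ) * √(mirrorStep t L k)) else
      √(mirrorStep t L k) ^ 3 / √(t : ℝ) + 4 * √(mirrorStep t L k) ^ 4 / t)) ≤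
      (∑ k, √(mirrorStep t L k) * (1 - mirrorStep t L k)) / √(t : ℝ) + 1 / t := by
  have hs : 0 < √(t : ℝ) := Real.sqrt_pos.2 (by exact_mod_cast ht)
  have htr : (0 : ℝ) < t := by exact_mod_cast ht
  have hp := mirrorStep_pos hK ht L
  have hsum := sum_mirrorStep hK ht L
  simp only [Finset.mul_sum]
  rw [Finset.sum_comm]
  have hk : ∀ k, ∑ j, mirrorStep t L j * (if k = j then
      (1 - mirrorStep t L k) ^ 2 / (√(t : ℝ) * √(mirrorStep t L k)) else
      √(mirrorStep t L k) ^ 3 / √(t : ℝ) + 4 * √(mirrorStep t L k) ^ 4 / t) ≤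
      √(mirrorStep t L k) * (1 - mirrorStep t L k) / √(t : ℝ) + mirrorStep t L k / t := by
    intro k
    rw [← Finset.add_sum_erase _ _ (Finset.mem_univ k)]
    have h1 : ∑ j ∈ Finset.univ.erase k, mirrorStep t L j * (if k = j then
      (1 - mirrorStep t L k) ^ 2 / (√(t : ℝ) * √(mirrorStep t L k)) else
      √(mirrorStep t L k) ^ 3 / √(t : ℝ) + 4 * √(mirrorStep t L k) ^ 4 / t) =
      (1 - mirrorStep t L k) * (√(mirrorStep t L k) ^ 3 / √(t : ℝ) +
        4 * √(mirrorStep t L k) ^ 4 / t) := by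
      rw [← hsum, ← Finset.add_sum_erase _ _ (Finset.mem_univ k), add_sub_cancel_left,
        Finset.sum_mul]
      refine Finset.sum_congr rfl fun j hj => ?_
      rw [if_neg (Finset.ne_of_mem_erase hj).symm]
    rw [h1, if_pos rfl]
    have hpk := hp k
    have hv : 0 < √(mirrorStep t L k) := Real.sqrt_pos.2 hpk
    have hsq := Real.sq_sqrt hpk.le
    generalize √(mirrorStep t L k) = v at *
    rw [← hsq]
    generalize √(t : ℝ) = s at *
    have h2 : v ^ 2 * ((1 - v ^ 2) ^ 2 / (s * v)) + (1 - v ^ 2) * (v ^ 3 / s + 4 * v ^ 4 / t) =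
        v * (1 - v ^ 2) / s + v ^ 2 / t * (4 * v ^ 2 * (1 - v ^ 2)) := by
      field_simp
      ring
    rw [h2]
    gcongr
    refine mul_le_of_le_one_right (by positivity) ?_
    nlinarith [sq_nonneg (2 * v ^ 2 - 1)]
  refine (Finset.sum_le_sum fun k _ => hk k).trans (le_of_eq ?_)
  rw [Finset.sum_add_distrib, ← Finset.sum_div, ← Finset.sum_div, hsum]

/-! ### Rounds, trajectories and expectations -/

theorem samplingDist_pos (hK : 1 ≤ K) (i : Bool) {t : ℕ} (h : History K t) (k : Fin K) :
    0 < samplingDist i h k := mirrorStep_pos hK t.succ_pos _ k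

theorem sum_samplingDist (hK : 1 ≤ K) (i : Bool) {t : ℕ} (h : History K t) :
    ∑ k, samplingDist i h k = 1 := sum_mirrorStep hK t.succ_pos _

theorem sum_feedbackProb (M : Matrix (Fin K) (Fin K) ℝ) (a b : Fin K) :
    ∑ o, feedbackProb M a b o = 1 := by
  rw [Fin.sum_univ_three]
  by_cases hab : a = b <;> simp [feedbackProb, hab]

theorem sum_feedbackProb_mul {M : Matrix (Fin K) (Fin K) ℝ} (hM : IsPreferenceMatrix M)
    (a b : Fin K) : ∑ o : Fin 3, feedbackProb M a b o * (((o : ℕ) : ℝ) / 2) = M a b := by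
  rw [Fin.sum_univ_three]
  by_cases hab : a = b
  · subst hab
    have := (hM a a).2
    simp [feedbackProb]
    linarith
  · simp [feedbackProb, hab]

theorem feedbackProb_nonneg {M : Matrix (Fin K) (Fin K) ℝ} (hM : IsPreferenceMatrix M)
    (a b : Fin K) (o : Fin 3) : 0 ≤ feedbackProb M a b o := by
  have := (hM a b).1
  unfold feedbackProb
  split_ifs <;> linarith [this.1, this.2]

theorem roundProb_nonneg (hK : 1 ≤ K) {P : Environment K} {t : ℕ} {h : History K t}
    (hM : IsPreferenceMatrix (P t h)) (r : Round K) : 0 ≤ roundProb P h r :=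
  mul_nonneg (mul_nonneg (samplingDist_pos hK _ _ _).le (samplingDist_pos hK _ _ _).le)
    (feedbackProb_nonneg hM _ _ _)

theorem sum_roundProb_mul (P : Environment K) {t : ℕ} (h : History K t) (f : Round K → ℝ) :
    ∑ r, roundProb P h r * f r = ∑ a, ∑ b, samplingDist true h a * samplingDist false h b *
      ∑ o, feedbackProb (P t h) a b o * f (fun i => if i then a else b, o) := by
  rw [Fintype.sum_prod_type, ← (Equiv.boolArrowEquivProd (Fin K)).symm.sum_comp, Fintype.sum_prod_type,
    Finset.sum_comm]
  refine Finset.sum_congr rfl fun a _ => Finset.sum_congr rfl fun b _ => ?_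
  rw [Finset.mul_sum]
  refine Finset.sum_congr rfl fun o _ => ?_
  have he : (Equiv.boolArrowEquivProd (Fin K)).symm (b, a) = fun i => if i then a else b := by
    funext i
    cases i <;> rfl
  rw [he, ← mul_assoc]
  simp [roundProb]

/-- The arm of player `i` has the distribution `samplingDist i h`. -/
theorem sum_roundProb_mul_arm (hK : 1 ≤ K) (P : Environment K) {t : ℕ} (h : History K t)
    (i : Bool) (g : Fin K → ℝ) :
    ∑ r, roundProb P h r * g (r.1 i) = ∑ k, samplingDist i h k * g k := by
  rw [sum_roundProb_mul]
  have h1 : ∀ a b, ∑ o, feedbackProb (P t h) a b o * g (if i then a else b) =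
      g (if i then a else b) := fun a b => by rw [← Finset.sum_mul, sum_feedbackProb, one_mul]
  simp only [h1]
  cases i
  · rw [Finset.sum_comm]
    refine Finset.sum_congr rfl fun b _ => ?_
    simp only [Bool.false_eq_true, if_false]
    rw [← Finset.sum_mul, ← Finset.sum_mul, sum_samplingDist hK, one_mul]
  · refine Finset.sum_congr rfl fun a _ => ?_
    simp only [if_true]
    rw [← Finset.sum_mul, ← Finset.mul_sum, sum_samplingDist hK, mul_one]

theorem sum_roundProb (hK : 1 ≤ K) (P : Environment K) {t : ℕ} (h : History K t) :
    ∑ r, roundProb P h r = 1 := by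
  have := sum_roundProb_mul_arm hK P h true fun _ => 1
  simpa [sum_samplingDist hK] using this

/-- The importance-weighted loss estimate is unbiased: in expectation it is the probability that
the opponent's arm is preferred over `k`. -/
theorem sum_roundProb_mul_lossEstimate (hK : 1 ≤ K) {P : Environment K} {t : ℕ}
    {h : History K t} (hM : IsPreferenceMatrix (P t h)) (i : Bool) (k : Fin K) :
    ∑ r, roundProb P h r * lossEstimate i (samplingDist i h) r k =
      ∑ r, roundProb P h r * (1 - P t h k (r.1 (!i))) := by
  rw [sum_roundProb_mul_arm hK P h (!i) fun j => 1 - P t h k j, sum_roundProb_mul]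
  have hp := (samplingDist_pos hK i h k).ne'
  have hcompl : ∀ a b, ∑ o : Fin 3, feedbackProb (P t h) a b o * (1 - ((o : ℕ) : ℝ) / 2) =
      1 - P t h a b := fun a b => by
    simp only [mul_sub, mul_one, Finset.sum_sub_distrib, sum_feedbackProb,
      sum_feedbackProb_mul hM]
  have hraw : ∀ a b, ∑ o : Fin 3, feedbackProb (P t h) a b o * ((o : ℕ) : ℝ) =
      2 * P t h a b := fun a b => by
    rw [← sum_feedbackProb_mul hM, Finset.mul_sum]
    exact Finset.sum_congr rfl fun o _ => by ring
  cases i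
  · refine Finset.sum_congr rfl fun a _ => ?_
    rw [Finset.sum_eq_single k]
    · simp only [lossEstimate, observedLoss, feedback, Bool.false_eq_true, if_false, if_true,
        ← mul_div_assoc, ← Finset.sum_div, hraw, Bool.not_false]
      have := (hM k a).2
      rw [show 1 - P t h k a = P t h a k by linarith]
      field_simp
    · intro b _ hb
      simp [lossEstimate, Ne.symm hb]
    · simp
  · rw [Finset.sum_comm]
    refine Finset.sum_congr rfl fun b _ => ?_
    rw [Finset.sum_eq_single k]
    · simp only [lossEstimate, observedLoss, feedback, if_true,
        ← mul_div_assoc, ← Finset.sum_div, hcompl, Bool.not_true]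
      field_simp
    · intro b _ hb
      simp [lossEstimate, Ne.symm hb]
    · simp

/-- Both players together: the expected instantaneous regret of the duel is half the sum of the
players' expected regrets against `k` with respect to their estimated losses. -/
theorem sum_roundProb_mul_regret (hK : 1 ≤ K) {P : Environment K} {t : ℕ}
    {h : History K t} (hM : IsPreferenceMatrix (P t h)) (k : Fin K) :
    ∑ r, roundProb P h r * (P t h k (r.1 true) + P t h k (r.1 false) - 1) =
      ∑ r, roundProb P h r * ∑ i : Bool,
        (observedLoss i r - lossEstimate i (samplingDist i h) r k) := by
  have h1 := sum_roundProb_mul_lossEstimate hK hM true k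
  have h2 := sum_roundProb_mul_lossEstimate hK hM false k
  have h3 : ∀ r : Round K, ∑ i : Bool,
      (observedLoss i r - lossEstimate i (samplingDist i h) r k) =
      1 - lossEstimate true (samplingDist true h) r k -
        lossEstimate false (samplingDist false h) r k := fun r => by
    rw [Fintype.sum_bool, ← observedLoss_true_add_false r]; ring
  simp only [h3, mul_sub, mul_one, mul_add, Finset.sum_sub_distrib, Finset.sum_add_distrib,
    Bool.not_true, Bool.not_false] at h1 h2 ⊢
  linarith

theorem before_snoc_castSucc {T : ℕ} (h : History K T) (r : Round K) (t : Fin T) :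
    History.before (Fin.snoc h r : History K (T + 1)) t.castSucc = h.before t := by
  funext s
  exact Fin.snoc_castSucc (α := fun _ => Round K) r h (Fin.castLE t.isLt.le s)

theorem before_snoc_last {T : ℕ} (h : History K T) (r : Round K) :
    History.before (Fin.snoc h r : History K (T + 1)) (Fin.last T) = h := by
  funext s
  exact Fin.snoc_castSucc (α := fun _ => Round K) r h s

theorem trajectoryProb_snoc (P : Environment K) {T : ℕ} (h : History K T) (r : Round K) :
    trajectoryProb P (Fin.snoc h r : History K (T + 1)) =
      trajectoryProb P h * roundProb P h r := by
  have hlast := before_snoc_last h r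
  have hcast := before_snoc_castSucc h r
  unfold trajectoryProb
  rw [Fin.prod_univ_castSucc]
  congr 1
  · refine Finset.prod_congr rfl fun t _ => ?_
    have h1 : (Fin.snoc h r : History K (T + 1)) t.castSucc = h t :=
      Fin.snoc_castSucc (α := fun _ => Round K) r h t
    rw [h1]
    exact congrArg (fun x => roundProb P x (h t)) (hcast t)
  · have h1 : (Fin.snoc h r : History K (T + 1)) (Fin.last T) = r :=
      Fin.snoc_last (α := fun _ => Round K) r h
    rw [h1]
    exact congrArg (fun x => roundProb P x r) hlast

theorem expectation_succ (P : Environment K) {T : ℕ} (f : History K (T + 1) → ℝ) :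
    expectation P f =
      expectation P fun h : History K T => ∑ r, roundProb P h r * f (Fin.snoc h r) := by
  unfold expectation
  rw [← (Fin.snocEquiv fun _ : Fin (T + 1) => Round K).sum_comp, Fintype.sum_prod_type,
    Finset.sum_comm]
  refine Finset.sum_congr rfl fun h _ => ?_
  rw [Finset.mul_sum]
  refine Finset.sum_congr rfl fun r _ => ?_
  rw [← mul_assoc, ← trajectoryProb_snoc]
  rfl

theorem trajectoryProb_nonneg (hK : 1 ≤ K) {P : Environment K}
    (hP : ∀ (t : ℕ) (h : History K t), IsPreferenceMatrix (P t h)) {T : ℕ} (ω : History K T) :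
    0 ≤ trajectoryProb P ω :=
  Finset.prod_nonneg fun _ _ => roundProb_nonneg hK (hP _ _) _

theorem expectation_mono (hK : 1 ≤ K) {P : Environment K}
    (hP : ∀ (t : ℕ) (h : History K t), IsPreferenceMatrix (P t h)) {T : ℕ}
    {f g : History K T → ℝ} (hfg : ∀ ω, f ω ≤ g ω) : expectation P f ≤ expectation P g :=
  Finset.sum_le_sum fun ω _ => mul_le_mul_of_nonneg_left (hfg ω) (trajectoryProb_nonneg hK hP ω)

theorem expectation_sub (P : Environment K) {T : ℕ} (f g : History K T → ℝ) :
    expectation P (fun ω => f ω - g ω) = expectation P f - expectation P g := by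
  simp only [expectation, mul_sub, Finset.sum_sub_distrib]

theorem expectation_const_mul (P : Environment K) {T : ℕ} (c : ℝ) (f : History K T → ℝ) :
    expectation P (fun ω => c * f ω) = c * expectation P f := by
  simp only [expectation, Finset.mul_sum]
  exact Finset.sum_congr rfl fun ω _ => by ring

theorem expectation_const (hK : 1 ≤ K) (P : Environment K) {T : ℕ} (c : ℝ) :
    expectation P (fun _ : History K T => c) = c := by
  induction T with
  | zero => simp [expectation, trajectoryProb]
  | succ T ih =>
    rw [expectation_succ]
    simpa only [← Finset.sum_mul, sum_roundProb hK, one_mul] using ih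

/-- A process that does not increase in conditional expectation does not increase in
expectation. -/
theorem expectation_le_of_supermartingale (hK : 1 ≤ K) {P : Environment K}
    (hP : ∀ (t : ℕ) (h : History K t), IsPreferenceMatrix (P t h))
    (M : (t : ℕ) → History K t → ℝ)
    (hM : ∀ t (h : History K t), ∑ r, roundProb P h r * M (t + 1) (Fin.snoc h r) ≤ M t h)
    {c : ℝ} (h0 : ∀ h, M 0 h ≤ c) (T : ℕ) : expectation P (M T) ≤ c := by
  induction T with
  | zero => exact (expectation_mono hK hP h0).trans_eq (expectation_const hK P c)
  | succ T ih =>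
    rw [expectation_succ]
    exact (expectation_mono hK hP (hM T)).trans ih

/-! ### Regret of two players -/

theorem neg_apply_add_sqrt_le_conjugate (t : ℕ) (L : EuclideanSpace ℝ (Fin K)) (k : Fin K) :
    -L k + √(t : ℝ) ≤ conjugate t (-L) := by
  refine le_trans (le_of_eq ?_) (le_conjugate t (-L) (single_mem_stdSimplex ℝ k))
  have h1 : ∀ j, √((Pi.single k 1 : Fin K → ℝ) j) = (Pi.single k 1 : Fin K → ℝ) j := fun j => by
    by_cases hj : j = k
    · subst hj; simp
    · simp [hj]
  simp only [h1, Finset.sum_add_distrib, ← Finset.mul_sum, (single_mem_stdSimplex ℝ k).2]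
  simp [Pi.single_apply]
  ring

theorem conjugate_zero_le (hK : 1 ≤ K) : conjugate 0 (-0 : EuclideanSpace ℝ (Fin K)) ≤ 0 := by
  have : NeZero K := ⟨by omega⟩
  have : Nonempty (stdSimplex ℝ (Fin K)) := ⟨⟨_, single_mem_stdSimplex ℝ (0 : Fin K)⟩⟩
  exact ciSup_le fun w => by simp [regularizer]

/-- The cost of changing the learning rate between two rounds. -/
def penalty (t : ℕ) (p : EuclideanSpace ℝ (Fin K)) : ℝ :=
  2 * (√((t + 1 : ℕ) : ℝ) - √(t : ℝ)) * (∑ k, √(p k) - 1)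

theorem conjugate_succ_sub_le (hK : 1 ≤ K) (t : ℕ) (L : EuclideanSpace ℝ (Fin K)) :
    conjugate (t + 1) (-L) - conjugate t (-L) ≤
      penalty t (mirrorStep (t + 1) L) + (√((t + 1 : ℕ) : ℝ) - √(t : ℝ)) := by
  have h1 := conjugate_eq_mirrorStep hK t.succ_pos L
  have h2 := le_conjugate t (-L) (mirrorStep_mem hK t.succ_pos L)
  simp only [Finset.sum_add_distrib, ← Finset.mul_sum, Nat.succ_eq_add_one] at h1 h2
  unfold penalty
  rw [h1]
  linarith

theorem cumulativeEstimate_snoc (i : Bool) {t : ℕ} (h : History K t) (r : Round K) :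
    cumulativeEstimate i (t + 1) (Fin.snoc h r : History K (t + 1)) =
      cumulativeEstimate i t h + lossEstimate i (samplingDist i h) r := by
  have h1 : (fun s : Fin t => (Fin.snoc h r : History K (t + 1)) s.castSucc) = h :=
    funext fun s => Fin.snoc_castSucc (α := fun _ => Round K) r h s
  have h2 : (Fin.snoc h r : History K (t + 1)) (Fin.last t) = r :=
    Fin.snoc_last (α := fun _ => Round K) r h
  rw [cumulativeEstimate, h1, h2, samplingDist]

theorem sum_before_snoc {T : ℕ} (f : (t : ℕ) → History K t → ℝ) (h : History K T)
    (r : Round K) :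
    ∑ t : Fin (T + 1), f t (History.before (Fin.snoc h r : History K (T + 1)) t) =
      ∑ t : Fin T, f t (h.before t) + f T h := by
  rw [Fin.sum_univ_castSucc]
  congr 1
  · exact Finset.sum_congr rfl fun t _ => congrArg (f t) (before_snoc_castSucc h r t)
  · exact congrArg (f T) (before_snoc_last h r)

theorem regret_snoc (P : Environment K) (k : Fin K) {T : ℕ} (h : History K T) (r : Round K) :
    regret P k (Fin.snoc h r : History K (T + 1)) =
      regret P k h + 1 / 2 * (P T h k (r.1 true) + P T h k (r.1 false) - 1) := by
  unfold regret
  rw [Fin.sum_univ_castSucc]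
  congr 1
  · refine Finset.sum_congr rfl fun t _ => ?_
    have h1 : (Fin.snoc h r : History K (T + 1)) t.castSucc = h t :=
      Fin.snoc_castSucc (α := fun _ => Round K) r h t
    rw [h1]
    exact congrArg (fun x => 1 / 2 * (P t x k ((h t).1 true) + P t x k ((h t).1 false) - 1))
      (before_snoc_castSucc h r t)
  · have h1 : (Fin.snoc h r : History K (T + 1)) (Fin.last T) = r :=
      Fin.snoc_last (α := fun _ => Round K) r h
    rw [h1]
    exact congrArg (fun x => 1 / 2 * (P T x k (r.1 true) + P T x k (r.1 false) - 1))
      (before_snoc_last h r)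

/-- The potential of player `i` relative to the comparator `k`. It is nonpositive and vanishes
initially, and its increments turn the estimated regret into stability and penalty terms. -/
def potential (k : Fin K) (i : Bool) (t : ℕ) (h : History K t) : ℝ :=
  -conjugate t (-cumulativeEstimate i t h) + √(t : ℝ) - cumulativeEstimate i t h k

theorem potential_nonpos (k : Fin K) (i : Bool) (t : ℕ) (h : History K t) :
    potential k i t h ≤ 0 := by
  have := neg_apply_add_sqrt_le_conjugate t (cumulativeEstimate i t h) k
  unfold potential
  linarith

/-- The one-step bound for player `i`, for each outcome `r` of the round: the estimated
regret is paid for by stability, penalty and the increment of the potential. -/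
theorem estimated_regret_le (hK : 1 ≤ K) (k : Fin K) (i : Bool) {t : ℕ} (h : History K t)
    (r : Round K) :
    observedLoss i r - lossEstimate i (samplingDist i h) r k -
        (potential k i (t + 1) (Fin.snoc h r) - potential k i t h) ≤
      stability (t + 1) (cumulativeEstimate i t h) i r + penalty t (samplingDist i h) := by
  have h1 := conjugate_succ_sub_le hK t (cumulativeEstimate i t h)
  unfold potential stability
  rw [cumulativeEstimate_snoc, PiLp.add_apply]
  unfold samplingDist at *
  linarith

/-- Regret bound for two players of follow-the-regularized-leader, in terms of an arbitrary bound
`S` for the conditional expectation of the stability terms. The bound does not depend on the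
comparator `k`. -/
theorem two_mul_expectation_regret_le (hK : 1 ≤ K) {P : Environment K}
    (hP : ∀ (t : ℕ) (h : History K t), IsPreferenceMatrix (P t h))
    (S : ℕ → EuclideanSpace ℝ (Fin K) → ℝ)
    (hS : ∀ t (h : History K t) i,
      ∑ r, roundProb P h r * stability (t + 1) (cumulativeEstimate i t h) i r ≤
        S t (samplingDist i h)) (k : Fin K) (T : ℕ) :
    2 * expectation P (regret (T := T) P k) ≤ expectation P fun ω : History K T =>
      ∑ t : Fin T, ∑ i : Bool,
        (S t (samplingDist i (ω.before t)) + penalty t (samplingDist i (ω.before t))) := by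
  set B : (t : ℕ) → History K t → ℝ := fun t h =>
    ∑ i : Bool, (S t (samplingDist i h) + penalty t (samplingDist i h)) with hB
  set M : (t : ℕ) → History K t → ℝ := fun t h => 2 * regret P k h -
    ∑ s : Fin t, B s (h.before s) - ∑ i : Bool, potential k i t h with hMdef
  have hM : ∀ t (h : History K t), ∑ r, roundProb P h r * M (t + 1) (Fin.snoc h r) ≤ M t h := by
    intro t h
    have hstep : ∀ r : Round K, M (t + 1) (Fin.snoc h r) ≤ M t h +
        (P t h k (r.1 true) + P t h k (r.1 false) - 1 -
          ∑ i : Bool, (observedLoss i r - lossEstimate i (samplingDist i h) r k)) +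
        ∑ i : Bool, (stability (t + 1) (cumulativeEstimate i t h) i r -
          S t (samplingDist i h)) := by
      intro r
      have h1 := estimated_regret_le hK k true h r
      have h2 := estimated_regret_le hK k false h r
      simp only [hMdef, regret_snoc, sum_before_snoc B h r]
      simp only [hB, Fintype.sum_bool]
      linarith
    have hsum := Finset.sum_le_sum fun r (_ : r ∈ Finset.univ) =>
      mul_le_mul_of_nonneg_left (hstep r) (roundProb_nonneg hK (hP t h) r)
    refine hsum.trans ?_
    have hreg := sum_roundProb_mul_regret hK (hP t h) k
    have hst : ∑ r, roundProb P h r * ∑ i : Bool,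
        (stability (t + 1) (cumulativeEstimate i t h) i r - S t (samplingDist i h)) ≤ 0 := by
      have h1 := hS t h true
      have h2 := hS t h false
      simp only [Fintype.sum_bool, mul_add, mul_sub, Finset.sum_add_distrib,
        Finset.sum_sub_distrib, ← Finset.sum_mul, sum_roundProb hK, one_mul]
      linarith
    simp only [mul_add, mul_sub _ (_ - 1 : ℝ), Finset.sum_add_distrib, Finset.sum_sub_distrib,
      ← Finset.sum_mul, sum_roundProb hK, one_mul] at hreg hst ⊢
    linarith
  have h0 : ∀ h, M 0 h ≤ 0 := fun h => by
    have := conjugate_zero_le hK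
    simp only [hMdef, regret, potential, cumulativeEstimate, Fintype.sum_bool]
    simp at *
    linarith
  have hfin := expectation_le_of_supermartingale hK hP M hM h0 T
  have hle : expectation P (fun ω : History K T =>
      2 * regret P k ω - ∑ t : Fin T, B t (ω.before t)) ≤ expectation P (M T) :=
    expectation_mono hK hP fun ω => by
      have h1 := potential_nonpos k true T ω
      have h2 := potential_nonpos k false T ω
      simp only [hMdef, Fintype.sum_bool]
      linarith
  rw [expectation_sub, expectation_const_mul] at hle
  linarith

/-! ### Regret bounds -/

theorem sum_roundProb_mul_stability_le (hK : 1 ≤ K) {P : Environment K}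
    (hP : ∀ (t : ℕ) (h : History K t), IsPreferenceMatrix (P t h)) (t : ℕ) (h : History K t)
    (i : Bool) :
    ∑ r, roundProb P h r * stability (t + 1) (cumulativeEstimate i t h) i r ≤
      (∑ k, √(samplingDist i h k)) / √((t + 1 : ℕ) : ℝ) := by
  refine (Finset.sum_le_sum fun r _ => mul_le_mul_of_nonneg_left
    (stability_le_inv_sqrt hK t.succ_pos _ i r) (roundProb_nonneg hK (hP t h) r)).trans_eq ?_
  rw [sum_roundProb_mul_arm hK P h i fun j =>
    1 / (√((t + 1 : ℕ) : ℝ) * √(mirrorStep (t + 1) (cumulativeEstimate i t h) j))]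
  exact sum_mul_stability_bound_eq hK t.succ_pos _

theorem sum_roundProb_mul_stability_le_one (hK : 1 ≤ K) {P : Environment K}
    (hP : ∀ (t : ℕ) (h : History K t), IsPreferenceMatrix (P t h)) (t : ℕ) (h : History K t)
    (i : Bool) :
    ∑ r, roundProb P h r * stability (t + 1) (cumulativeEstimate i t h) i r ≤ 1 := by
  rw [← sum_roundProb hK P h]
  exact Finset.sum_le_sum fun r _ => mul_le_of_le_one_right (roundProb_nonneg hK (hP t h) r)
    (stability_le_one hK t.succ_pos _ i r)

theorem sum_roundProb_mul_stability_le_shifted (hK : 1 ≤ K) {P : Environment K}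
    (hP : ∀ (t : ℕ) (h : History K t), IsPreferenceMatrix (P t h)) {t : ℕ} (ht : 1 ≤ t)
    (h : History K t) (i : Bool) :
    ∑ r, roundProb P h r * stability (t + 1) (cumulativeEstimate i t h) i r ≤
      (∑ k, √(samplingDist i h k) * (1 - samplingDist i h k)) / √((t + 1 : ℕ) : ℝ) +
        1 / ((t + 1 : ℕ) : ℝ) := by
  refine (Finset.sum_le_sum fun r _ => mul_le_mul_of_nonneg_left
    (stability_le_shifted hK (by omega) _ i r) (roundProb_nonneg hK (hP t h) r)).trans ?_
  rw [sum_roundProb_mul_arm hK P h i fun j => ∑ k, (if k = j then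
      (1 - mirrorStep (t + 1) (cumulativeEstimate i t h) k) ^ 2 /
        (√((t + 1 : ℕ) : ℝ) * √(mirrorStep (t + 1) (cumulativeEstimate i t h) k)) else
      √(mirrorStep (t + 1) (cumulativeEstimate i t h) k) ^ 3 / √((t + 1 : ℕ) : ℝ) +
        4 * √(mirrorStep (t + 1) (cumulativeEstimate i t h) k) ^ 4 / ((t + 1 : ℕ) : ℝ))]
  exact sum_mul_shifted_bound_le hK t.succ_pos _

theorem sum_sqrt_le {p : Fin K → ℝ} (hp : p ∈ stdSimplex ℝ (Fin K)) : ∑ k, √(p k) ≤ √(K : ℝ) := by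
  refine Real.le_sqrt_of_sq_le ?_
  have h := sq_sum_le_card_mul_sum_sq (s := Finset.univ) (f := fun k => √(p k))
  simpa [Real.sq_sqrt (hp.1 _), hp.2] using h

theorem samplingDist_mem (hK : 1 ≤ K) (i : Bool) {t : ℕ} (h : History K t) :
    (fun k => samplingDist i h k) ∈ stdSimplex ℝ (Fin K) := mirrorStep_mem hK t.succ_pos _

theorem sqrt_succ_sq_sub (t : ℕ) : √((t + 1 : ℕ) : ℝ) ^ 2 - √(t : ℝ) ^ 2 = 1 := by
  rw [Real.sq_sqrt (Nat.cast_nonneg _), Real.sq_sqrt (Nat.cast_nonneg _)]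
  push_cast
  ring

theorem one_div_le_two_mul_sub {a b : ℝ} (hb : 0 < b) (hab : b ^ 2 - a ^ 2 = 1) :
    1 / b ≤ 2 * (b - a) := by
  rw [div_le_iff₀ hb]
  nlinarith [sq_nonneg (b - a)]

theorem pseudoRegret_le_four_mul_sqrt (hK : 1 ≤ K) {P : Environment K}
    (hP : ∀ (t : ℕ) (h : History K t), IsPreferenceMatrix (P t h)) (T : ℕ) :
    pseudoRegret P T ≤ 4 * √((K : ℝ) * (T : ℝ)) := by
  have : NeZero K := ⟨by omega⟩
  refine ciSup_le fun k => ?_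
  have h := two_mul_expectation_regret_le hK hP
    (fun t p => (∑ k, √(p k)) / √((t + 1 : ℕ) : ℝ))
    (fun t h i => sum_roundProb_mul_stability_le hK hP t h i) k T
  have hround : ∀ (t : ℕ) (h : History K t) (i : Bool),
      (∑ k, √(samplingDist i h k)) / √((t + 1 : ℕ) : ℝ) + penalty t (samplingDist i h) ≤
        4 * √(K : ℝ) * (√((t + 1 : ℕ) : ℝ) - √(t : ℝ)) := by
    intro t h i
    have hs := sum_sqrt_le (samplingDist_mem hK i h)
    have hb : 0 < √((t + 1 : ℕ) : ℝ) := Real.sqrt_pos.2 (by positivity)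
    have h1 := one_div_le_two_mul_sub hb (sqrt_succ_sq_sub t)
    have h0 : 0 ≤ ∑ k, √(samplingDist i h k) := Finset.sum_nonneg fun _ _ => Real.sqrt_nonneg _
    have h2 : 0 ≤ 1 / √((t + 1 : ℕ) : ℝ) := by positivity
    unfold penalty
    generalize ∑ k, √(samplingDist i h k) = σ at *
    rw [div_eq_mul_one_div]
    nlinarith [mul_le_mul_of_nonneg_left h1 h0]
  have hpath : ∀ ω : History K T, (∑ t : Fin T, ∑ i : Bool,
      ((∑ k, √(samplingDist i (ω.before t) k)) / √((t + 1 : ℕ) : ℝ) +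
        penalty t (samplingDist i (ω.before t)))) ≤ 8 * √((K : ℝ) * (T : ℝ)) := by
    intro ω
    calc _ ≤ ∑ t : Fin T, ∑ _i : Bool,
          4 * √(K : ℝ) * (√(((t : ℕ) + 1 : ℕ) : ℝ) - √((t : ℕ) : ℝ)) :=
          Finset.sum_le_sum fun t _ => Finset.sum_le_sum fun i _ => hround t _ i
      _ = 8 * √(K : ℝ) * ∑ t ∈ Finset.range T, (√((t + 1 : ℕ) : ℝ) - √(t : ℝ)) := by
          rw [Finset.mul_sum, ← Fin.sum_univ_eq_sum_range
            (fun t : ℕ => 8 * √(K : ℝ) * (√((t + 1 : ℕ) : ℝ) - √(t : ℝ)))]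
          refine Finset.sum_congr rfl fun t _ => ?_
          rw [Fintype.sum_bool]
          ring
      _ = _ := by
          rw [Finset.sum_range_sub (fun t : ℕ => √(t : ℝ)), Real.sqrt_mul (Nat.cast_nonneg K)]
          simp [mul_assoc]
  have := (expectation_mono hK hP hpath).trans_eq (expectation_const hK P _)
  linarith

/-- The scalar inequality behind the self-bounding argument: `r` is `√t` times the gap and `v` the
square root of the probability of an arm. The leading part `4 v - r v²` has maximum `4 / r`. -/
theorem self_bounding_scalar {v r : ℝ} (hv : 0 ≤ v) (hr : 0 < r) :
    4 * v + v ^ 2 - 2 * v ^ 3 - r * v ^ 2 ≤ 4 / r + 6 / (r + 2) ^ 2 := by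
  obtain ⟨q, rfl⟩ : ∃ q, r = q - 2 := ⟨r + 2, by ring⟩
  rw [sub_add_cancel]
  have hq : 2 < q := by linarith
  have hq0 : 0 < q := by linarith
  -- The cubic term is replaced by its tangent `v³ ≥ 2 a v² - a² v` at `a = 2 / q`, close to the
  -- maximizer `2 / r`, which leaves a quadratic in `v`.
  have h1 : 2 * (2 / q) * v ^ 2 - (2 / q) ^ 2 * v ≤ v ^ 3 := by
    nlinarith [mul_nonneg hv (sq_nonneg (v - 2 / q))]
  have hB : 0 < q ^ 2 - 3 * q + 8 := by nlinarith
  have h2 : 4 * v + v ^ 2 - 2 * v ^ 3 - (q - 2) * v ^ 2 ≤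
      2 * (2 * (q ^ 2 + 2) / q ^ 2) * v - (q ^ 2 - 3 * q + 8) / q * v ^ 2 := by
    have e1 : 2 * (2 * (q ^ 2 + 2) / q ^ 2) = 4 + 2 * (2 / q) ^ 2 := by field_simp; ring
    have e2 : (q ^ 2 - 3 * q + 8) / q = q - 3 + 4 * (2 / q) := by field_simp; ring
    rw [e1, e2]
    linarith
  have h3 : 2 * (2 * (q ^ 2 + 2) / q ^ 2) * v - (q ^ 2 - 3 * q + 8) / q * v ^ 2 ≤
      (2 * (q ^ 2 + 2) / q ^ 2) ^ 2 / ((q ^ 2 - 3 * q + 8) / q) := by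
    have hB' : 0 < (q ^ 2 - 3 * q + 8) / q := by positivity
    rw [le_div_iff₀ hB']
    generalize (q ^ 2 - 3 * q + 8) / q = B at *
    generalize 2 * (q ^ 2 + 2) / q ^ 2 = A at *
    nlinarith [sq_nonneg (A - B * v)]
  have h4 : (2 * (q ^ 2 + 2) / q ^ 2) ^ 2 / ((q ^ 2 - 3 * q + 8) / q) =
      4 * (q ^ 2 + 2) ^ 2 / (q ^ 3 * (q ^ 2 - 3 * q + 8)) := by
    field_simp
    ring
  have h5 : 4 / (q - 2) + 6 / q ^ 2 = (4 * q ^ 2 + 6 * q - 12) / ((q - 2) * q ^ 2) := by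
    have : q - 2 ≠ 0 := by linarith
    field_simp
    ring
  refine h2.trans (h3.trans ?_)
  rw [h4, h5, div_le_div_iff₀ (by positivity) (by have := sub_pos.2 hq; positivity)]
  have h6 : 0 ≤ 2 * q ^ 4 - 14 * q ^ 3 + 116 * q ^ 2 - 112 * q + 32 := by
    nlinarith [sq_nonneg (q * (2 * q - 7))]
  nlinarith [mul_nonneg (sq_nonneg q) h6]

/-- Bound for the contribution of one arm with gap `D` to twice the regret minus the self-bounding
term in round `t + 1`. The first round has its own value because the shifted loss estimates are
only used afterwards. -/
def armCost (D : ℝ) (t : ℕ) : ℝ :=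
  if t = 0 then 4 / D else
    4 / (((t + 1 : ℕ) : ℝ) * D) + 6 / (√((t + 1 : ℕ) : ℝ) * (D * √((t + 1 : ℕ) : ℝ) + 2) ^ 2) +
      1 / √((t + 1 : ℕ) : ℝ) ^ 3

theorem one_div_succ_le_log_sub {n : ℕ} (hn : 1 ≤ n) :
    1 / ((n + 1 : ℕ) : ℝ) ≤ Real.log ((n + 1 : ℕ) : ℝ) - Real.log (n : ℝ) := by
  have hn0 : (0 : ℝ) < n := by exact_mod_cast hn
  have hn1 : (0 : ℝ) < ((n + 1 : ℕ) : ℝ) := by positivity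
  rw [← Real.log_div hn1.ne' hn0.ne']
  refine le_trans (le_of_eq ?_) (Real.one_sub_inv_le_log_of_pos (by positivity))
  push_cast
  field_simp
  ring

/-- The three parts of `armCost` are dominated by increments of `log t`, of
`-1 / (D * √t + 2)` and of `-1 / √t`. -/
theorem sum_armCost_le_telescoping {D : ℝ} (hD : 0 < D) {T : ℕ} (hT : 1 ≤ T) :
    ∑ t ∈ Finset.range T, armCost D t ≤ (4 * Real.log (T : ℝ) + 4) / D +
      12 / D * (1 / (D + 2) - 1 / (D * √(T : ℝ) + 2)) + 2 * (1 - 1 / √(T : ℝ)) := by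
  induction T, hT using Nat.le_induction with
  | base => simp [armCost]
  | succ n hn ih =>
    rw [Finset.sum_range_succ]
    have hlog := one_div_succ_le_log_sub hn
    have hab := sqrt_succ_sq_sub n
    have ha : 0 < √(n : ℝ) := Real.sqrt_pos.2 (by exact_mod_cast hn)
    have hb : 0 < √((n + 1 : ℕ) : ℝ) := Real.sqrt_pos.2 (by positivity)
    have hm : (0 : ℝ) < ((n + 1 : ℕ) : ℝ) := by positivity
    have hn0 : n ≠ 0 := by omega
    rw [armCost, if_neg hn0]
    generalize √(n : ℝ) = a at *
    generalize √((n + 1 : ℕ) : ℝ) = b at *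
    have hab' : a ≤ b := by nlinarith
    have hdiff : b - a = 1 / (a + b) := by
      rw [eq_div_iff (by positivity)]; linarith
    have h1 : 4 / (((n + 1 : ℕ) : ℝ) * D) ≤
        (4 * Real.log ((n + 1 : ℕ) : ℝ) + 4) / D - (4 * Real.log (n : ℝ) + 4) / D := by
      rw [← sub_div, ← div_div]
      gcongr
      rw [div_eq_mul_one_div]
      linarith
    have h2 : 6 / (b * (D * b + 2) ^ 2) ≤
        12 / D * (1 / (D * a + 2) - 1 / (D * b + 2)) := by
      have e : 12 / D * (1 / (D * a + 2) - 1 / (D * b + 2)) =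
          12 / ((a + b) * ((D * a + 2) * (D * b + 2))) := by
        have : 1 / (D * a + 2) - 1 / (D * b + 2) =
          D * (b - a) / ((D * a + 2) * (D * b + 2)) := by field_simp; ring
        rw [this, hdiff]
        field_simp
      rw [e, div_le_div_iff₀ (by positivity) (by positivity)]
      have h3 : (a + b) * ((D * a + 2) * (D * b + 2)) ≤
          (b + b) * ((D * b + 2) * (D * b + 2)) := by gcongr
      linarith
    have h3 : 1 / b ^ 3 ≤ 2 * (1 / a - 1 / b) := by
      have e : 2 * (1 / a - 1 / b) = 2 / (a * b * (a + b)) := by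
        have : 1 / a - 1 / b = (b - a) / (a * b) := by field_simp
        rw [this, hdiff]
        field_simp
      rw [e, div_le_div_iff₀ (by positivity) (by positivity)]
      have h3 : a * b * (a + b) ≤ b * b * (b + b) := by gcongr
      linarith
    linarith

theorem sum_armCost_le {D : ℝ} (hD : 0 < D) (hD1 : D ≤ 1) {T : ℕ} (hT : 1 ≤ T) :
    ∑ t ∈ Finset.range T, armCost D t ≤ (4 * Real.log (T : ℝ) + 12) / D := by
  refine (sum_armCost_le_telescoping hD hT).trans ?_
  have h1 : 12 / D * (1 / (D + 2) - 1 / (D * √(T : ℝ) + 2)) ≤ 6 / D := by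
    have h2 : 1 / (D + 2) ≤ 1 / 2 := one_div_le_one_div_of_le (by norm_num) (by linarith)
    have h3 : 0 ≤ 1 / (D * √(T : ℝ) + 2) := by positivity
    calc _ ≤ 12 / D * (1 / 2) := by gcongr; linarith
      _ = 6 / D := by ring
  have h2 : 2 * (1 - 1 / √(T : ℝ)) ≤ 2 / D := by
    have h3 : 0 ≤ 1 / √(T : ℝ) := by positivity
    have h4 : 2 ≤ 2 / D := by rw [le_div_iff₀ hD]; linarith
    linarith
  have h3 : (4 * Real.log (T : ℝ) + 12) / D =
      (4 * Real.log (T : ℝ) + 4) / D + 6 / D + 2 / D := by ring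
  linarith

/-- Bound for the conditional expectation of the stability term. In the first round the shifted
estimates do not help, and the trivial bound is used. -/
def stabilityBound (t : ℕ) (p : EuclideanSpace ℝ (Fin K)) : ℝ :=
  if t = 0 then 1 else
    (∑ k, √(p k) * (1 - p k)) / √((t + 1 : ℕ) : ℝ) + 1 / ((t + 1 : ℕ) : ℝ)

/-- One arm other than the reference arm, after the first round: `a = √t`, `b = √(t + 1)`, and `c`
is the coefficient of the penalty, which exceeds `1 / b` by at most `1 / (2 * b ^ 3)`. -/
theorem arm_contribution_le {a b c v D : ℝ} (ha : 1 ≤ a) (hb : 0 < b) (hab : b ^ 2 - a ^ 2 = 1)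
    (hc : c = 2 * (b - a)) (hv : 0 ≤ v) (hv1 : v ≤ 1) (hD : 0 < D) :
    2 * (v * (1 - v ^ 2)) / b + 2 * v ^ 2 / b - c * v ^ 2 + 2 * c * v - v ^ 2 * D ≤
      4 / (b ^ 2 * D) + 6 / (b * (D * b + 2) ^ 2) + 1 / b ^ 3 := by
  have h1 : 1 / b ≤ c := hc ▸ one_div_le_two_mul_sub hb hab
  have hdiff : b - a = 1 / (a + b) := by
    rw [eq_div_iff (by positivity)]; linarith
  have hba : a ≤ b := by nlinarith
  have h2 : c ≤ 1 / b + 1 / (2 * b ^ 3) := by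
    have e : 1 / b + 1 / (2 * b ^ 3) = (2 * b ^ 2 + 1) / (2 * b ^ 3) := by field_simp
    rw [hc, hdiff, e, mul_one_div, div_le_div_iff₀ (by positivity) (by positivity)]
    have hone : (b - a) * (a + b) = 1 := by linarith
    have hsq : 2 * b ^ 2 ≤ (a + b) ^ 2 := by nlinarith
    have h6 : 2 * b ^ 2 * (b - a) ≤ a + b := by
      refine le_of_mul_le_mul_right ?_ (show 0 < a + b by positivity)
      calc 2 * b ^ 2 * (b - a) * (a + b) = 2 * b ^ 2 * ((b - a) * (a + b)) := by ring
        _ ≤ (a + b) * (a + b) := by rw [hone]; linarith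
    linarith
  have h3 := self_bounding_scalar hv (mul_pos hD hb)
  have h4 : (4 * v + v ^ 2 - 2 * v ^ 3 - D * b * v ^ 2) / b ≤
      (4 / (D * b) + 6 / (D * b + 2) ^ 2) / b := by gcongr
  have e4 : (4 / (D * b) + 6 / (D * b + 2) ^ 2) / b =
      4 / (b ^ 2 * D) + 6 / (b * (D * b + 2) ^ 2) := by field_simp
  have e5 : (4 * v + v ^ 2 - 2 * v ^ 3 - D * b * v ^ 2) / b =
      2 * (v * (1 - v ^ 2)) / b + 2 * v ^ 2 / b - 1 / b * v ^ 2 + 2 * (1 / b) * v - v ^ 2 * D := by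
    field_simp
    ring
  have h5 : 1 / b * v ^ 2 ≤ c * v ^ 2 := by gcongr
  have h6 : 2 * c * v ≤ 2 * (1 / b) * v + 1 / b ^ 3 := by
    have h7 : c * v ≤ (1 / b + 1 / (2 * b ^ 3)) * v := by gcongr
    have h8 : 1 / b ^ 3 * v ≤ 1 / b ^ 3 := mul_le_of_le_one_right (by positivity) hv1
    have e9 : 2 * ((1 / b + 1 / (2 * b ^ 3)) * v) = 2 * (1 / b) * v + 1 / b ^ 3 * v := by
      field_simp
    linarith
  linarith

/-- One round, one player. The terms of the reference arm `kstar` are traded for terms of the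
other arms through `1 - p kstar = ∑ k ≠ kstar, p k`. -/
theorem round_cost_le {p : EuclideanSpace ℝ (Fin K)}
    (hp : (fun k => p k) ∈ stdSimplex ℝ (Fin K)) {Δ : Fin K → ℝ} {kstar : Fin K}
    (hΔ : ∀ k, k ≠ kstar → 0 < Δ k ∧ Δ k ≤ 1) (t : ℕ) :
    2 * (stabilityBound t p + penalty t p) - ∑ k ∈ Finset.univ.erase kstar, p k * Δ k ≤
      ∑ k ∈ Finset.univ.erase kstar, armCost (Δ k) t + 2 / ((t + 1 : ℕ) : ℝ) := by
  have hp1 : ∀ k, p k ≤ 1 := fun k => by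
    rw [← hp.2]
    exact Finset.single_le_sum (f := fun k => p k) (fun k _ => hp.1 k) (Finset.mem_univ k)
  have hv1 : ∀ k, √(p k) ≤ 1 := fun k => Real.sqrt_le_one.2 (hp1 k)
  have hsq : ∀ k, √(p k) ^ 2 = p k := fun k => Real.sq_sqrt (hp.1 k)
  have hpos : ∀ k, 0 ≤ √(p k) := fun k => Real.sqrt_nonneg _
  have hsplit : ∑ k, √(p k) = √(p kstar) + ∑ k ∈ Finset.univ.erase kstar, √(p k) :=
    (Finset.add_sum_erase _ _ (Finset.mem_univ kstar)).symm
  by_cases ht : t = 0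
  · subst ht
    have h1 : ∑ k ∈ Finset.univ.erase kstar, 4 * √(p k) ≤
        ∑ k ∈ Finset.univ.erase kstar, 4 / Δ k := by
      refine Finset.sum_le_sum fun k hk => ?_
      obtain ⟨h2, h3⟩ := hΔ k (Finset.ne_of_mem_erase hk)
      have h4 : 4 ≤ 4 / Δ k := by rw [le_div_iff₀ h2]; linarith
      linarith [hv1 k]
    have h2 : 0 ≤ ∑ k ∈ Finset.univ.erase kstar, p k * Δ k := Finset.sum_nonneg fun k hk =>
      mul_nonneg (hp.1 k) (hΔ k (Finset.ne_of_mem_erase hk)).1.le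
    rw [← Finset.mul_sum] at h1
    have h3 := hv1 kstar
    simp only [stabilityBound, penalty, armCost, if_true, hsplit]
    simp only [zero_add, Nat.cast_one, Nat.cast_zero, Real.sqrt_one, Real.sqrt_zero]
    linarith
  · have hab := sqrt_succ_sq_sub t
    have ha : 1 ≤ √(t : ℝ) := Real.one_le_sqrt.2 (by exact_mod_cast Nat.one_le_iff_ne_zero.2 ht)
    have hb : 0 < √((t + 1 : ℕ) : ℝ) := Real.sqrt_pos.2 (by positivity)
    have hb2 : ((t + 1 : ℕ) : ℝ) = √((t + 1 : ℕ) : ℝ) ^ 2 :=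
      (Real.sq_sqrt (Nat.cast_nonneg _)).symm
    simp only [stabilityBound, penalty, armCost, if_neg ht, hsplit]
    rw [← Finset.add_sum_erase _ (fun k => √(p k) * (1 - p k)) (Finset.mem_univ kstar)]
    have hc := one_div_le_two_mul_sub hb hab
    generalize √(t : ℝ) = a at *
    generalize √((t + 1 : ℕ) : ℝ) = b at *
    rw [hb2]
    obtain ⟨c, hcdef⟩ : ∃ c, c = 2 * (b - a) := ⟨_, rfl⟩
    rw [← hcdef] at hc ⊢
    have hrest : 1 - p kstar = ∑ k ∈ Finset.univ.erase kstar, p k := by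
      rw [← hp.2, ← Finset.add_sum_erase _ _ (Finset.mem_univ kstar)]
      ring
    have harm := Finset.sum_le_sum fun k (hk : k ∈ Finset.univ.erase kstar) =>
      arm_contribution_le ha hb hab hcdef (hpos k) (hv1 k)
        (hΔ k (Finset.ne_of_mem_erase hk)).1
    simp only [hsq] at harm
    have hexp : ∑ k ∈ Finset.univ.erase kstar,
        (2 * (√(p k) * (1 - p k)) / b + 2 * p k / b - c * p k + 2 * c * √(p k) - p k * Δ k) =
        2 * (∑ k ∈ Finset.univ.erase kstar, √(p k) * (1 - p k)) / b + 2 * (1 - p kstar) / b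
          - c * (1 - p kstar) + 2 * c * ∑ k ∈ Finset.univ.erase kstar, √(p k)
          - ∑ k ∈ Finset.univ.erase kstar, p k * Δ k := by
      rw [hrest]
      simp only [Finset.mul_sum, Finset.sum_div, Finset.sum_sub_distrib, Finset.sum_add_distrib]
    rw [hexp] at harm
    have hstar1 : 2 * (√(p kstar) * (1 - p kstar)) / b ≤ 2 * (1 - p kstar) / b := by
      gcongr
      exact mul_le_of_le_one_left (sub_nonneg.2 (hp1 kstar)) (hv1 kstar)
    have hstar2 : 2 * c * (√(p kstar) - 1) ≤ -(c * (1 - p kstar)) := by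
      have hc0 : 0 ≤ c := le_trans (by positivity) hc
      have := hsq kstar
      nlinarith [mul_nonneg hc0 (sq_nonneg (√(p kstar) - 1))]
    have e : 2 * ((√(p kstar) * (1 - p kstar) +
        ∑ k ∈ Finset.univ.erase kstar, √(p k) * (1 - p k)) / b + 1 / b ^ 2 +
        c * (√(p kstar) + ∑ k ∈ Finset.univ.erase kstar, √(p k) - 1)) =
        2 * (√(p kstar) * (1 - p kstar)) / b +
          2 * (∑ k ∈ Finset.univ.erase kstar, √(p k) * (1 - p k)) / b + 2 / b ^ 2 +
          2 * c * (√(p kstar) - 1) + 2 * c * ∑ k ∈ Finset.univ.erase kstar, √(p k) := by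
      ring
    rw [e]
    linarith

theorem sum_two_div_succ_le {T : ℕ} (hT : 1 ≤ T) :
    ∑ t ∈ Finset.range T, 2 / ((t + 1 : ℕ) : ℝ) ≤ 2 + 2 * Real.log (T : ℝ) := by
  induction T, hT using Nat.le_induction with
  | base => simp
  | succ n hn ih =>
    rw [Finset.sum_range_succ, div_eq_mul_one_div]
    linarith [one_div_succ_le_log_sub hn]

theorem pseudoRegret_le_of_selfBounding (hK : 1 ≤ K) {P : Environment K}
    (hP : ∀ (t : ℕ) (h : History K t), IsPreferenceMatrix (P t h)) {T : ℕ} (hT : 1 ≤ T)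
    {Δ : Fin K → ℝ} {kstar : Fin K} {C : ℝ}
    (hΔ : ∀ k, k ≠ kstar → 0 < Δ k ∧ Δ k ≤ 1) (hself : SelfBounding P T Δ kstar C) :
    pseudoRegret P T ≤ ∑ k ∈ Finset.univ.erase kstar, (4 * Real.log (T : ℝ) + 12) / Δ k +
      2 * Real.log (T : ℝ) + 2 + C := by
  have : NeZero K := ⟨by omega⟩
  have hS : ∀ t (h : History K t) i,
      ∑ r, roundProb P h r * stability (t + 1) (cumulativeEstimate i t h) i r ≤
        stabilityBound t (samplingDist i h) := by
    intro t h i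
    unfold stabilityBound
    split_ifs with ht
    · exact sum_roundProb_mul_stability_le_one hK hP t h i
    · exact sum_roundProb_mul_stability_le_shifted hK hP (Nat.one_le_iff_ne_zero.2 ht) h i
  have hreg : pseudoRegret P T ≤ 1 / 2 * expectation P fun ω : History K T =>
      ∑ t : Fin T, ∑ i : Bool, (stabilityBound t (samplingDist i (ω.before t)) +
        penalty t (samplingDist i (ω.before t))) :=
    ciSup_le fun k => by linarith [two_mul_expectation_regret_le hK hP _ hS k T]
  unfold SelfBounding at hself
  set X : History K T → ℝ := fun ω => ∑ t : Fin T, ∑ i : Bool,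
    (stabilityBound t (samplingDist i (ω.before t)) +
      penalty t (samplingDist i (ω.before t))) with hX
  set Y : History K T → ℝ := fun ω => ∑ t : Fin T, ∑ k ∈ Finset.univ.erase kstar,
    (samplingDist true (ω.before t) k + samplingDist false (ω.before t) k) * Δ k with hY
  have hpath : ∀ ω, 2 * X ω - Y ω ≤
      2 * (∑ k ∈ Finset.univ.erase kstar, (4 * Real.log (T : ℝ) + 12) / Δ k +
        2 * Real.log (T : ℝ) + 2) := by
    intro ω
    have hround : ∀ t : Fin T, 2 * (∑ i : Bool,
        (stabilityBound t (samplingDist i (ω.before t)) +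
          penalty t (samplingDist i (ω.before t)))) - ∑ k ∈ Finset.univ.erase kstar,
        (samplingDist true (ω.before t) k + samplingDist false (ω.before t) k) * Δ k ≤
        2 * (∑ k ∈ Finset.univ.erase kstar, armCost (Δ k) t +
          2 / (((t : ℕ) + 1 : ℕ) : ℝ)) := by
      intro t
      have h1 := round_cost_le (samplingDist_mem hK true (ω.before t)) hΔ t
      have h2 := round_cost_le (samplingDist_mem hK false (ω.before t)) hΔ t
      simp only [add_mul, Finset.sum_add_distrib, Fintype.sum_bool]
      linarith
    calc 2 * X ω - Y ω ≤ ∑ t : Fin T, 2 * (∑ k ∈ Finset.univ.erase kstar, armCost (Δ k) t +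
          2 / (((t : ℕ) + 1 : ℕ) : ℝ)) := by
          rw [hX, hY, Finset.mul_sum, ← Finset.sum_sub_distrib]
          exact Finset.sum_le_sum fun t _ => hround t
      _ = 2 * (∑ k ∈ Finset.univ.erase kstar, ∑ t ∈ Finset.range T, armCost (Δ k) t +
          ∑ t ∈ Finset.range T, 2 / ((t + 1 : ℕ) : ℝ)) := by
          rw [Fin.sum_univ_eq_sum_range (fun t : ℕ => 2 * (∑ k ∈ Finset.univ.erase kstar,
            armCost (Δ k) t + 2 / ((t + 1 : ℕ) : ℝ))), ← Finset.mul_sum,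
            Finset.sum_add_distrib, Finset.sum_comm]
      _ ≤ _ := by
          have h1 := Finset.sum_le_sum fun k (hk : k ∈ Finset.univ.erase kstar) =>
            sum_armCost_le (hΔ k (Finset.ne_of_mem_erase hk)).1
              (hΔ k (Finset.ne_of_mem_erase hk)).2 hT
          have h2 := sum_two_div_succ_le hT
          linarith
  have hE := (expectation_mono hK hP hpath).trans_eq (expectation_const hK P _)
  rw [expectation_sub, expectation_const_mul] at hE
  -- `R = 2 R - R`: the first copy is bounded by the regret bound, the second by self-bounding.
  linarith

end Dueling

end

theorem mainTheorem1 (K : ℕ) (hK : 1 ≤ K) (P : Dueling.Environment K)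
    (hP : ∀ (t : ℕ) (h : Dueling.History K t), Dueling.IsPreferenceMatrix (P t h))
    (T : ℕ) (hT : 1 ≤ T) :
    Dueling.pseudoRegret P T ≤ 4 * √((K : ℝ) * (T : ℝ)) + 1 ∧
    ∀ (Δ : Fin K → ℝ) (kstar : Fin K) (C : ℝ),
      2 ≤ K → (∀ k, Δ k ∈ Set.Icc (0 : ℝ) 1) → (∀ k, Δ k = 0 ↔ k = kstar) → 0 ≤ C →
      Dueling.SelfBounding P T Δ kstar C →
      Dueling.pseudoRegret P T ≤
        ∑ k ∈ Finset.univ.erase kstar, (4 * Real.log (T : ℝ) + 12) / Δ k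
          + 4 * Real.log (T : ℝ) + 1 / (⨅ k : {k : Fin K // k ≠ kstar}, Δ k)
          + 3 / 2 * √(K : ℝ) + 8 + C := by
  refine ⟨(Dueling.pseudoRegret_le_four_mul_sqrt hK hP T).trans (by linarith), ?_⟩
  intro Δ kstar C _ hΔ hzero _ hself
  have h := Dueling.pseudoRegret_le_of_selfBounding hK hP hT (fun k hk =>
    ⟨lt_of_le_of_ne (hΔ k).1 fun h0 => hk ((hzero k).1 h0.symm), (hΔ k).2⟩) hself
  have hlog : 0 ≤ Real.log (T : ℝ) := Real.log_nonneg (by exact_mod_cast hT)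
  have hmin : 0 ≤ 1 / (⨅ k : {k : Fin K // k ≠ kstar}, Δ k) :=
    one_div_nonneg.2 (Real.iInf_nonneg fun k => (hΔ k).1)
  have hsqrt : 0 ≤ 3 / 2 * √(K : ℝ) := by positivity
  linarith
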